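/- **Single Label Clique Theorem.** Let $0<\alpha<1$, let $m=m(n)$ be non-negative integers with $m\sim n^{\alpha}$ as $n\to\infty$ (for example $n^\alpha$ rounded up or down to an integer), and let $p=p(n)\in[0,1]$ satisfy $mp^2=O(1)$. Let $G_{n,m,p}$ be the random intersection graph on a set $V$ of $n$ vertices: each vertex $v$ chooses a random set $S_v\subseteq\{1,\dots,m\}$ of labels, containing each label with probability $p$, all choices being independent, and two distinct vertices $u,v$ are adjacent if and only if $S_u\cap S_v\neq\emptyset$. Put $L_i=\{v\in V: i\in S_v\}$, and say that a set $Q$ of vertices is formed by a single label if $Q\subseteq L_i$ for some label $i$. Then: 1. With high probability every clique $Q$ of size $|Q|\sim np$ with at least two vertices is formed by a single label; that is, for every sequence $\varepsilon_n\to 0$, the probability that every clique $Q$ of $G_{n,m,p}$ with $|Q|\ge 2$ and $\bigl||Q|-np\bigr|\le\varepsilon_n\,np$ is formed by a single label tends to $1$ as $n\to\infty$. 2. In particular, with high probability every maximum clique (clique of largest size) of $G_{n,m,p}$ that has at least two vertices is formed by a single label. -/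

import Mathlib

open MeasureTheory Filter Asymptotics
open scoped Topology

/-- An outcome of the label choices of `n` vertices among `m` labels (equivalently, the associated
bipartite graph): `ω v i = true` means that the vertex `v` has chosen the label `i`. -/
abbrev LabelChoice (n m : ℕ) : Type := Fin n → Fin m → Bool

namespace LabelChoice

variable {n m : ℕ}

/-- The set `S_v` of labels chosen by the vertex `v`. -/
def labelsOf (ω : LabelChoice n m) (v : Fin n) : Finset (Fin m) :=
  Finset.univ.filter fun i => ω v i = true

/-- The set `L_i` of vertices that have chosen the label `i`. -/
def verticesOf (ω : LabelChoice n m) (i : Fin m) : Finset (Fin n) :=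
  Finset.univ.filter fun v => i ∈ ω.labelsOf v

/-- The intersection graph of the sets `S_v`: distinct vertices `u`, `v` are adjacent if and only
if `S_u ∩ S_v` is nonempty. -/
def intersectionGraph (ω : LabelChoice n m) : SimpleGraph (Fin n) where
  Adj u v := u ≠ v ∧ (ω.labelsOf u ∩ ω.labelsOf v).Nonempty
  symm := ⟨fun u v h => ⟨h.1.symm, by rw [Finset.inter_comm]; exact h.2⟩⟩
  loopless := ⟨fun _ h => h.1 rfl⟩

/-- The vertex set `Q` is formed by a single label: `Q ⊆ L_i` for some label `i`. -/
def FormedBySingleLabel (ω : LabelChoice n m) (Q : Finset (Fin n)) : Prop :=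
  ∃ i : Fin m, Q ⊆ ω.verticesOf i

end LabelChoice

/-- The law of the label choices in the random intersection graphs model with parameters
`n`, `m`, `p`: every vertex chooses every label with probability `p`, all choices being
independent. -/
noncomputable def randomLabelChoice (n m : ℕ) (p : unitInterval) : Measure (LabelChoice n m) :=
  Measure.pi fun _ : Fin n => Measure.pi fun _ : Fin m =>
    ProbabilityTheory.bernoulliMeasure true false p

/-! Both claims concern cliques `Q` with at least about `(1 - κ/8) np` vertices that no single label
covers, where `κ > 0` is a constant: each `L_i` is itself a clique and one fixed `L_i` is this large
with high probability, so maximum cliques are this large too. Fix the scale `b = ⌈n^β⌉` with a small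
`β > 0`; then `log n` is negligible against `b`.

Sparse case, `b n m p² ≤ 1`. A clique not covered by one label contains a triangle whose three edges
come from three different labels (`exists_multilabel_triangle`). The expected number of these is at
most `(n m p²)³ ≤ b⁻³`.

Dense case, `b n m p² > 1`. Here `np ≥ b³`. Let `i` be a label covering most vertices of `Q` and let
`v ∈ Q` lack `i`. Since two sets `L_j` share fewer than `np/16` vertices, every other label covers
at most 5/8 of `Q`. Hence `Q` contains a set `T` of `10 b` vertices such that each label other than
`i` is missed by at least `b` of them (`exists_spread_subset`). All remaining vertices of `Q` are
common neighbours of `T ∪ {v}`.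

For fixed labels on `T ∪ {v}`, a fresh vertex `x` can be adjacent to all of it in three ways: `x`
has `i` and also meets `S_v`, with probability at most `(1 - κ) p`; `x` has two of the few labels
shared inside `T`; or `x` meets at least `b` disjoint sets of labels, which is exponentially
unlikely in `b` (`massOf_row_hits_le`). In total this is at most `(1 - κ/2) p`, so having `(1 - κ/4)
np` such vertices is a large deviation of probability `exp(-Ω(np))`. As `np ≥ b³`, this beats the
`n^(10b+1) = exp(O(b²))` choices of `T` and `v`. -/

/-! ### Weighted counting on finite types -/

open Classical in
/-- The total weight of the points with property `P`. -/
noncomputable def massOf {Ω : Type*} [Fintype Ω] (w : Ω → ℝ) (P : Ω → Prop) : ℝ :=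
  ∑ ω, if P ω then w ω else 0

section massOf

variable {Ω : Type*} [Fintype Ω] {w : Ω → ℝ}

theorem massOf_congr {P Q : Ω → Prop} (h : ∀ ω, P ω ↔ Q ω) : massOf w P = massOf w Q := by
  rw [show P = Q from funext fun ω => propext (h ω)]

theorem massOf_mono (hw : ∀ ω, 0 ≤ w ω) {P Q : Ω → Prop} (h : ∀ ω, P ω → Q ω) :
    massOf w P ≤ massOf w Q := by
  refine Finset.sum_le_sum fun ω _ => ?_
  by_cases hP : P ω
  · simp [hP, h ω hP]
  · rw [if_neg hP]; split_ifs <;> simp [hw]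

/-- Markov's inequality; the Chernoff bounds apply it to exponential moments. -/
theorem massOf_le_sum_mul (hw : ∀ ω, 0 ≤ w ω) {P : Ω → Prop} {f : Ω → ℝ} (hf : ∀ ω, 0 ≤ f ω)
    (h : ∀ ω, P ω → 1 ≤ f ω) : massOf w P ≤ ∑ ω, w ω * f ω := by
  refine Finset.sum_le_sum fun ω _ => ?_
  split_ifs with hP
  · exact le_mul_of_one_le_right (hw ω) (h ω hP)
  · exact mul_nonneg (hw ω) (hf ω)

theorem massOf_or_le (hw : ∀ ω, 0 ≤ w ω) (P Q : Ω → Prop) :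
    massOf w (fun ω => P ω ∨ Q ω) ≤ massOf w P + massOf w Q := by
  unfold massOf
  rw [← Finset.sum_add_distrib]
  refine Finset.sum_le_sum fun ω _ => ?_
  have := hw ω
  by_cases hP : P ω <;> by_cases hQ : Q ω <;> simp [hP, hQ, this]

theorem massOf_exists_le (hw : ∀ ω, 0 ≤ w ω) {ι : Type*} (s : Finset ι) (P : ι → Ω → Prop) :
    massOf w (fun ω => ∃ i ∈ s, P i ω) ≤ ∑ i ∈ s, massOf w (P i) := by
  classical
  induction s using Finset.induction_on with
  | empty => simp [massOf]
  | insert a s ha ih =>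
    rw [Finset.sum_insert ha]
    refine le_trans (le_of_eq (massOf_congr fun ω => ?_))
      ((massOf_or_le hw (P a) fun ω => ∃ i ∈ s, P i ω).trans (by gcongr))
    simp

theorem massOf_exists_le_card_mul (hw : ∀ ω, 0 ≤ w ω) {ι : Type*} (s : Finset ι)
    (P : ι → Ω → Prop) {x : ℝ} (h : ∀ i ∈ s, massOf w (P i) ≤ x) :
    massOf w (fun ω => ∃ i ∈ s, P i ω) ≤ s.card * x := by
  refine (massOf_exists_le hw s P).trans ((Finset.sum_le_sum h).trans ?_)
  simp

theorem massOf_and_not (P Q : Ω → Prop) :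
    massOf w (fun ω => P ω ∧ ¬ Q ω) = massOf w P - massOf w (fun ω => P ω ∧ Q ω) := by
  unfold massOf
  rw [← Finset.sum_sub_distrib]
  refine Finset.sum_congr rfl fun ω _ => ?_
  by_cases hP : P ω <;> by_cases hQ : Q ω <;> simp [hP, hQ]

theorem massOf_eq_sum_mul (P : Ω → Prop) [DecidablePred P] :
    massOf w P = ∑ ω, w ω * if P ω then 1 else 0 := by
  unfold massOf
  refine Finset.sum_congr rfl fun ω _ => ?_
  split_ifs <;> simp

end massOf

theorem sum_pi_prod {ι A : Type*} [Fintype ι] [Fintype A] [DecidableEq ι] (f : ι → A → ℝ) :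
    ∑ a : ι → A, ∏ i, f i (a i) = ∏ i, ∑ x, f i x := by
  rw [Finset.prod_univ_sum, Fintype.piFinset_univ]

/-! ### The weights of label choices -/

/-- The probability that a single vertex makes the label choice `a`. -/
noncomputable def rowWeight {m : ℕ} (p : ℝ) (a : Fin m → Bool) : ℝ :=
  ∏ i, if a i = true then p else 1 - p

/-- The probability of the outcome `ω`. -/
noncomputable def choiceWeight {n m : ℕ} (p : ℝ) (ω : LabelChoice n m) : ℝ :=
  ∏ v, rowWeight p (ω v)

section weights

variable {n m : ℕ} {p : ℝ}

theorem rowWeight_nonneg (h0 : 0 ≤ p) (h1 : p ≤ 1) (a : Fin m → Bool) : 0 ≤ rowWeight p a :=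
  Finset.prod_nonneg fun i _ => by split_ifs <;> linarith

theorem choiceWeight_nonneg (h0 : 0 ≤ p) (h1 : p ≤ 1) (ω : LabelChoice n m) :
    0 ≤ choiceWeight p ω :=
  Finset.prod_nonneg fun _ _ => rowWeight_nonneg h0 h1 _

theorem sum_rowWeight_mul_prod (g : Fin m → Bool → ℝ) :
    ∑ a : Fin m → Bool, rowWeight p a * ∏ i, g i (a i) =
      ∏ i, (p * g i true + (1 - p) * g i false) := by
  simp_rw [rowWeight, ← Finset.prod_mul_distrib]
  rw [sum_pi_prod fun i x => (if x = true then p else 1 - p) * g i x]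
  simp

theorem sum_choiceWeight_mul_prod (f : Fin n → (Fin m → Bool) → ℝ) :
    ∑ ω : LabelChoice n m, choiceWeight p ω * ∏ v, f v (ω v) =
      ∏ v, ∑ a, rowWeight p a * f v a := by
  simp_rw [choiceWeight, ← Finset.prod_mul_distrib]
  exact sum_pi_prod fun v a => rowWeight p a * f v a

theorem sum_rowWeight : ∑ a : Fin m → Bool, rowWeight p a = 1 := by
  simpa using sum_rowWeight_mul_prod (m := m) (p := p) fun _ _ => 1

theorem sum_choiceWeight : ∑ ω : LabelChoice n m, choiceWeight p ω = 1 := by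
  simpa [sum_rowWeight] using sum_choiceWeight_mul_prod (n := n) (m := m) (p := p) fun _ _ => 1

/-- The bridge from the product measure to finite weighted sums, in which all estimates are carried
out. -/
theorem randomLabelChoice_real (p : unitInterval) (s : Set (LabelChoice n m)) :
    (randomLabelChoice n m p).real s = massOf (choiceWeight (p : ℝ)) (· ∈ s) := by
  classical
  have hsing : ∀ ω, (randomLabelChoice n m p).real {ω} = choiceWeight (p : ℝ) ω := by
    intro ω
    simp only [randomLabelChoice, choiceWeight, rowWeight, measureReal_def, Measure.pi_singleton,
      ENNReal.toReal_prod]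
    refine Finset.prod_congr rfl fun v _ => Finset.prod_congr rfl fun i _ => ?_
    rw [← measureReal_def,
      ProbabilityTheory.bernoulliMeasure_real_apply p (MeasurableSet.of_discrete)]
    cases ω v i <;> simp
  have : IsProbabilityMeasure (randomLabelChoice n m p) := by
    unfold randomLabelChoice; infer_instance
  have hs : s = ((Finset.univ.filter (· ∈ s) : Finset (LabelChoice n m)) : Set _) := by ext; simp
  conv_lhs => rw [hs]
  rw [← sum_measureReal_singleton, Finset.sum_filter, massOf]
  refine Finset.sum_congr rfl fun ω _ => ?_
  rw [hsing]

theorem massOf_incidences (E : Finset (Fin n × Fin m)) :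
    massOf (choiceWeight p) (fun ω : LabelChoice n m => ∀ e ∈ E, ω e.1 e.2 = true) =
      p ^ E.card := by
  classical
  have key : ∀ ω : LabelChoice n m, (if ∀ e ∈ E, ω e.1 e.2 = true then (1 : ℝ) else 0) =
      ∏ v, ∏ i, if (v, i) ∈ E then (if ω v i = true then 1 else 0) else 1 := by
    intro ω
    split_ifs with h
    · symm
      refine Finset.prod_eq_one fun v _ => Finset.prod_eq_one fun i _ => ?_
      split_ifs with h1 h2
      · rfl
      · exact absurd (h _ h1) h2
      · rfl
    · push Not at h
      obtain ⟨e, he, h⟩ := h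
      symm
      refine Finset.prod_eq_zero (Finset.mem_univ e.1) (Finset.prod_eq_zero (Finset.mem_univ e.2) ?_)
      simp [he, h]
  rw [massOf_eq_sum_mul]
  simp_rw [key]
  rw [sum_choiceWeight_mul_prod fun v a =>
    ∏ i, if (v, i) ∈ E then (if a i = true then (1 : ℝ) else 0) else 1]
  have : ∀ v : Fin n, (∑ a, rowWeight p a *
      ∏ i, if (v, i) ∈ E then (if a i = true then (1 : ℝ) else 0) else 1) =
      ∏ i, if (v, i) ∈ E then p else 1 := by
    intro v
    rw [sum_rowWeight_mul_prod fun i x => if (v, i) ∈ E then (if x = true then (1 : ℝ) else 0) else 1]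
    refine Finset.prod_congr rfl fun i _ => ?_
    by_cases h : (v, i) ∈ E <;> simp [h]
  simp_rw [this]
  rw [← Fintype.prod_prod_type' (fun v i => if (v, i) ∈ E then p else 1)]
  simp [Finset.prod_ite_mem]

theorem massOf_row_subset_disjoint (A B : Finset (Fin m)) (hAB : Disjoint A B) :
    massOf (rowWeight p) (fun a => (∀ i ∈ A, a i = true) ∧ ∀ i ∈ B, a i = false) =
      p ^ A.card * (1 - p) ^ B.card := by
  classical
  have key : ∀ a : Fin m → Bool,
      (if (∀ i ∈ A, a i = true) ∧ ∀ i ∈ B, a i = false then (1 : ℝ) else 0) =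
      ∏ i, if (i ∈ A ∧ a i = false) ∨ (i ∈ B ∧ a i = true) then 0 else 1 := by
    intro a
    split_ifs with h
    · symm
      refine Finset.prod_eq_one fun i _ => ?_
      rw [if_neg]
      rintro (⟨h1, h2⟩ | ⟨h1, h2⟩)
      · simp [h.1 i h1] at h2
      · simp [h.2 i h1] at h2
    · rw [not_and_or] at h
      push Not at h
      rcases h with ⟨i, hi, h⟩ | ⟨i, hi, h⟩
      · exact (Finset.prod_eq_zero (Finset.mem_univ i) (by simp_all)).symm
      · exact (Finset.prod_eq_zero (Finset.mem_univ i) (by simp_all)).symm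
  rw [massOf_eq_sum_mul]
  simp_rw [key]
  rw [sum_rowWeight_mul_prod fun i x =>
    if (i ∈ A ∧ x = false) ∨ (i ∈ B ∧ x = true) then (0 : ℝ) else 1]
  have : ∀ i, (p * (if (i ∈ A ∧ true = false) ∨ (i ∈ B ∧ true = true) then (0 : ℝ) else 1) +
      (1 - p) * if (i ∈ A ∧ false = false) ∨ (i ∈ B ∧ false = true) then (0 : ℝ) else 1) =
      (if i ∈ A then p else 1) * if i ∈ B then 1 - p else 1 := by
    intro i
    have : i ∈ A → i ∉ B := fun h => Finset.disjoint_left.1 hAB h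
    by_cases h1 : i ∈ A <;> by_cases h2 : i ∈ B <;> simp_all
  rw [Finset.prod_congr rfl fun i _ => this i, Finset.prod_mul_distrib]
  simp [Finset.prod_ite_mem]

theorem massOf_row_mem (i : Fin m) : massOf (rowWeight p) (fun a => a i = true) = p := by
  simpa using massOf_row_subset_disjoint (p := p) {i} ∅ (by simp)

theorem massOf_row_pair {i j : Fin m} (h : i ≠ j) :
    massOf (rowWeight p) (fun a => a i = true ∧ a j = true) = p ^ 2 := by
  simpa [Finset.card_pair h] using massOf_row_subset_disjoint (p := p) {i, j} ∅ (by simp)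

theorem massOf_row_mem_hits {i : Fin m} {D : Finset (Fin m)} (h : i ∉ D) :
    massOf (rowWeight p) (fun a => a i = true ∧ ∃ j ∈ D, a j = true) =
      p * (1 - (1 - p) ^ D.card) := by
  have h1 := massOf_row_subset_disjoint (p := p) {i} D (by simpa using h)
  have h2 := massOf_and_not (w := rowWeight p) (fun a : Fin m → Bool => a i = true)
    (fun a => ∀ j ∈ D, a j = false)
  simp only [Finset.mem_singleton, forall_eq, Finset.card_singleton, pow_one] at h1
  rw [h1, massOf_row_mem] at h2
  rw [mul_sub, mul_one, ← h2]
  refine massOf_congr fun a => ?_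
  simp

/-- The events of hitting pairwise disjoint sets of labels are independent. -/
theorem massOf_row_hits_all {ι : Type*} [DecidableEq ι] (U : Finset ι) (D : ι → Finset (Fin m))
    (hD : (U : Set ι).PairwiseDisjoint D) :
    massOf (rowWeight p) (fun a => ∀ u ∈ U, ∃ j ∈ D u, a j = true) =
      ∏ u ∈ U, (1 - (1 - p) ^ (D u).card) := by
  classical
  -- Inclusion–exclusion over the sets `D u` that are avoided; disjointness makes the avoidance
  -- probabilities multiply.
  have key : ∀ a : Fin m → Bool, (if ∀ u ∈ U, ∃ j ∈ D u, a j = true then (1 : ℝ) else 0) =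
      ∑ t ∈ U.powerset, (-1) ^ t.card * if ∀ j ∈ t.biUnion D, a j = false then (1 : ℝ) else 0 := by
    intro a
    have h1 : (if ∀ u ∈ U, ∃ j ∈ D u, a j = true then (1 : ℝ) else 0) =
        ∏ u ∈ U, (1 + -(if ∀ j ∈ D u, a j = false then (1 : ℝ) else 0)) := by
      split_ifs with h
      · symm
        refine Finset.prod_eq_one fun u hu => ?_
        obtain ⟨j, hj, hja⟩ := h u hu
        rw [if_neg (fun h' => by simp [h' j hj] at hja)]; simp
      · push Not at h
        obtain ⟨u, hu, h⟩ := h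
        exact (Finset.prod_eq_zero hu (by rw [if_pos fun j hj => by simpa using h j hj]; simp)).symm
    rw [h1, Finset.prod_one_add]
    refine Finset.sum_congr rfl fun t ht => ?_
    rw [Finset.prod_neg]
    congr 1
    split_ifs with h
    · refine Finset.prod_eq_one fun u hu => if_pos fun j hj => h j (Finset.mem_biUnion.2 ⟨u, hu, hj⟩)
    · push Not at h
      obtain ⟨j, hj, h⟩ := h
      obtain ⟨u, hu, hj⟩ := Finset.mem_biUnion.1 hj
      exact Finset.prod_eq_zero hu (if_neg fun h' => h (h' j hj))
  rw [massOf_eq_sum_mul]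
  simp_rw [key, Finset.mul_sum]
  rw [Finset.sum_comm]
  simp_rw [sub_eq_add_neg (1 : ℝ) (( _ : ℝ) ^ _)]
  rw [Finset.prod_one_add]
  refine Finset.sum_congr rfl fun t ht => ?_
  rw [Finset.prod_neg, Finset.prod_pow_eq_pow_sum, ← Finset.card_biUnion]
  · have := massOf_row_subset_disjoint (p := p) ∅ (t.biUnion D) (by simp)
    simp only [Finset.notMem_empty, false_imp_iff, implies_true, true_and, Finset.card_empty,
      pow_zero, one_mul] at this
    rw [← this, massOf_eq_sum_mul, Finset.mul_sum]
    refine Finset.sum_congr rfl fun a _ => by ring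
  · intro u hu v hv huv
    exact hD (Finset.mem_powerset.1 ht hu) (Finset.mem_powerset.1 ht hv) huv

end weights

/-! ### Tail bounds for label sets, vertex sets and common neighbours -/

section tails

variable {n m : ℕ} {p : ℝ}

/-- A bound for the probability that a random set of labels meets all of the sets `S u`, where
`u ∈ insert v T`. Here `i` is the only label that may belong to almost all of the sets `S u`, and it
does not belong to `S v`. -/
theorem massOf_row_hits_le (h0 : 0 ≤ p) (h1 : p ≤ 1) {ι : Type*} [DecidableEq ι]
    (S : ι → Finset (Fin m))
    (T : Finset ι) (v : ι) (i : Fin m) (s K b : ℕ) (hiv : i ∉ S v) (hv : (S v).card ≤ s)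
    (hcard : ∀ u ∈ T, (S u).card ≤ s)
    (hinter : ∀ u ∈ T, ∀ w ∈ T, u ≠ w → (S u ∩ S w).card ≤ K)
    (hmiss : ∀ j, j ≠ i → b ≤ (T.filter fun u => j ∉ S u).card) (hbT : b ≤ T.card) :
    massOf (rowWeight p) (fun a => ∀ u ∈ insert v T, ∃ j ∈ S u, a j = true) ≤
      p * (1 - (1 - p) ^ s) + ((T.card : ℝ) ^ 2 * K) ^ 2 * p ^ 2 +
        (m + 1) * (1 - (1 - p) ^ s) ^ b := by
  classical
  -- `M` collects the labels other than `i` that lie in two of the sets `S u`; outside `M` and `i`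
  -- the sets become the pairwise disjoint `D u`. The index `some j` of `U` stands for `j` being the
  -- only label of `M` chosen, `none` for no label of `M` being chosen.
  set M : Finset (Fin m) := (T.offDiag.biUnion fun e => S e.1 ∩ S e.2).erase i with hM
  set D : ι → Finset (Fin m) := fun u => (S u \ M).erase i with hD
  set U : Option (Fin m) → Finset ι := fun o => o.elim T fun j => T.filter fun u => j ∉ S u with hU
  have hw := rowWeight_nonneg (m := m) h0 h1
  have hq0 : 0 ≤ 1 - p := by linarith
  have hq1 : 1 - p ≤ 1 := by linarith
  have hpow : ∀ k : ℕ, (1 - p) ^ k ≤ 1 := fun k => pow_le_one₀ hq0 hq1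
  have hMcard : (M.card : ℝ) ≤ (T.card : ℝ) ^ 2 * K := by
    have h2 : M.card ≤ T.offDiag.card * K := by
      refine (Finset.card_erase_le).trans (Finset.card_biUnion_le_card_mul _ _ _ fun e he => ?_)
      rw [Finset.mem_offDiag] at he
      exact hinter _ he.1 _ he.2.1 he.2.2
    have h3 : T.offDiag.card ≤ T.card ^ 2 := by
      rw [Finset.offDiag_card, sq]; omega
    exact_mod_cast h2.trans (Nat.mul_le_mul_right _ h3)
  -- Either `i` is chosen, and then a label of `S v` as well, or two labels of `M` are chosen, or at
  -- most one label `j` of `M` is. In the last case every `S u` missing `j` must be met inside `D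
  -- u`.
  have hcover : ∀ a : Fin m → Bool, (∀ u ∈ insert v T, ∃ j ∈ S u, a j = true) →
      (((a i = true ∧ ∃ j ∈ S v, a j = true) ∨
        ∃ e ∈ M.offDiag, a e.1 = true ∧ a e.2 = true) ∨
      ∃ o ∈ (Finset.univ : Finset (Option (Fin m))).erase (some i),
        ∀ u ∈ U o, ∃ j ∈ D u, a j = true) := by
    intro a ha
    by_cases hai : a i = true
    · exact Or.inl (Or.inl ⟨hai, ha v (Finset.mem_insert_self _ _)⟩)
    by_cases hpair : ∃ e ∈ M.offDiag, a e.1 = true ∧ a e.2 = true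
    · exact Or.inl (Or.inr hpair)
    refine Or.inr ?_
    by_cases hone : ∃ j ∈ M, a j = true
    · obtain ⟨j, hj, haj⟩ := hone
      refine ⟨some j, by simpa using Finset.ne_of_mem_erase hj, fun u hu => ?_⟩
      simp only [hU, Option.elim_some, Finset.mem_filter] at hu
      obtain ⟨l, hl, hal⟩ := ha u (Finset.mem_insert_of_mem hu.1)
      refine ⟨l, ?_, hal⟩
      simp only [hD, Finset.mem_erase, Finset.mem_sdiff]
      refine ⟨fun h => hai (h ▸ hal), hl, fun hlM => ?_⟩
      by_cases hlj : l = j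
      · exact hu.2 (hlj ▸ hl)
      · exact hpair ⟨(l, j), Finset.mem_offDiag.2 ⟨hlM, hj, hlj⟩, hal, haj⟩
    · refine ⟨none, by simp, fun u hu => ?_⟩
      simp only [hU, Option.elim_none] at hu
      obtain ⟨l, hl, hal⟩ := ha u (Finset.mem_insert_of_mem hu)
      refine ⟨l, ?_, hal⟩
      simp only [hD, Finset.mem_erase, Finset.mem_sdiff]
      exact ⟨fun h => hai (h ▸ hal), hl, fun hlM => hone ⟨l, hlM, hal⟩⟩
  refine (massOf_mono hw hcover).trans ((massOf_or_le hw _ _).trans (add_le_add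
    ((massOf_or_le hw _ _).trans (add_le_add ?_ ?_)) ?_))
  · rw [massOf_row_mem_hits hiv]
    have := pow_le_pow_of_le_one hq0 hq1 hv
    gcongr
  · refine (massOf_exists_le_card_mul hw M.offDiag (fun e a => a e.1 = true ∧ a e.2 = true)
      (x := p ^ 2) fun e he => ?_).trans ?_
    · rw [massOf_row_pair (Finset.mem_offDiag.1 he).2.2]
    · have h2 : (M.offDiag.card : ℝ) ≤ (M.card : ℝ) ^ 2 := by
        have : M.offDiag.card ≤ M.card ^ 2 := by rw [Finset.offDiag_card, sq]; omega
        exact_mod_cast this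
      gcongr
      exact h2.trans (by gcongr)
  · refine (massOf_exists_le_card_mul hw _ (fun o a => ∀ u ∈ U o, ∃ j ∈ D u, a j = true)
      (x := (1 - (1 - p) ^ s) ^ b) fun o ho => ?_).trans ?_
    · have hUT : U o ⊆ T := by
        cases o with
        | none => simp [hU]
        | some j => simp [hU]
      have hUb : b ≤ (U o).card := by
        cases o with
        | none => simpa [hU] using hbT
        | some j =>
          simp only [Finset.mem_erase, ne_eq, Option.some.injEq] at ho
          simpa [hU] using hmiss j ho.1
      rw [massOf_row_hits_all]
      · calc ∏ u ∈ U o, (1 - (1 - p) ^ (D u).card) ≤ ∏ u ∈ U o, (1 - (1 - p) ^ s) := by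
              refine Finset.prod_le_prod (fun u _ => by linarith [hpow (D u).card]) fun u hu => ?_
              have : (D u).card ≤ s := (Finset.card_le_card ((Finset.erase_subset _ _).trans
                Finset.sdiff_subset)).trans (hcard u (hUT hu))
              linarith [pow_le_pow_of_le_one hq0 hq1 this]
          _ = (1 - (1 - p) ^ s) ^ (U o).card := by simp
          _ ≤ _ := pow_le_pow_of_le_one (by linarith [hpow s]) (by linarith [pow_nonneg hq0 s]) hUb
      · intro u hu w hw huw
        simp only [Function.onFun]
        rw [Finset.disjoint_left]
        intro l hl hl'
        simp only [hD, Finset.mem_erase, Finset.mem_sdiff] at hl hl'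
        refine hl.2.2 (Finset.mem_erase.2 ⟨hl.1, Finset.mem_biUnion.2 ⟨(u, w), ?_, ?_⟩⟩)
        · exact Finset.mem_offDiag.2 ⟨hUT hu, hUT hw, huw⟩
        · exact Finset.mem_inter.2 ⟨hl.2.1, hl'.2.1⟩
    · have h2 : ((Finset.univ : Finset (Option (Fin m))).erase (some i)).card ≤ m + 1 :=
        (Finset.card_erase_le).trans (by simp)
      have h3 : (((Finset.univ : Finset (Option (Fin m))).erase (some i)).card : ℝ) ≤ m + 1 := by
        exact_mod_cast h2
      have : 0 ≤ (1 - (1 - p) ^ s) ^ b := pow_nonneg (by linarith [hpow s]) _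
      gcongr

theorem sum_rowWeight_mul_ite (P : (Fin m → Bool) → Prop) [DecidablePred P] (x : ℝ) :
    ∑ a, rowWeight p a * (if P a then x else 1) = 1 + (x - 1) * massOf (rowWeight p) P := by
  rw [massOf_eq_sum_mul, Finset.mul_sum]
  nth_rewrite 2 [← sum_rowWeight (m := m) (p := p)]
  rw [← Finset.sum_add_distrib]
  refine Finset.sum_congr rfl fun a _ => ?_
  split_ifs <;> ring

/-- Bounds the moment generating function of a Bernoulli variable, using `e^y - 1 ≤ y + y²` for `|y|
≤ 1`. It serves both the upper and the lower tail. -/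
theorem one_add_exp_sub_one_mul_le {x y : ℝ} (hy : |y| ≤ 1) (hx : 0 ≤ x) :
    1 + (Real.exp y - 1) * x ≤ Real.exp (x * (y + y ^ 2)) := by
  have h1 := (abs_le.1 (Real.abs_exp_sub_one_sub_id_le hy)).2
  have h2 : (Real.exp y - 1) * x ≤ (y + y ^ 2) * x := by gcongr; linarith
  linarith [Real.add_one_le_exp (x * (y + y ^ 2))]

theorem prod_ite_exp_eq {ι : Type*} (s : Finset ι) (P : ι → Prop) [DecidablePred P] (y : ℝ) :
    ∏ v ∈ s, (if P v then Real.exp y else 1) = Real.exp (y * (s.filter P).card) := by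
  rw [Finset.prod_ite]
  simp [← Real.exp_nat_mul, mul_comm]

/-- Lower tail of the number of vertices with the label `i`. -/
theorem massOf_card_verticesOf_le (h0 : 0 ≤ p) (h1 : p ≤ 1) (i : Fin m) {y : ℝ} (hy0 : 0 ≤ y)
    (hy1 : y ≤ 1) (t : ℝ) :
    massOf (choiceWeight p) (fun ω : LabelChoice n m => ((ω.verticesOf i).card : ℝ) ≤ t) ≤
      Real.exp (n * p * (-y + y ^ 2) + y * t) := by
  have hy : |-y| ≤ 1 := by rw [abs_neg, abs_le]; constructor <;> linarith
  calc _ ≤ ∑ ω : LabelChoice n m, choiceWeight p ω *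
        (Real.exp (y * t) * ∏ v, if ω v i = true then Real.exp (-y) else 1) := by
        refine massOf_le_sum_mul (choiceWeight_nonneg h0 h1) (fun ω => ?_) fun ω hω => ?_
        · exact mul_nonneg (Real.exp_pos _).le
            (Finset.prod_nonneg fun v _ => by split_ifs <;> positivity)
        · rw [prod_ite_exp_eq, ← Real.exp_add, Real.one_le_exp_iff]
          have : (Finset.univ.filter fun v => ω v i = true) = ω.verticesOf i := by
            ext; simp [LabelChoice.verticesOf, LabelChoice.labelsOf]
          rw [this]
          nlinarith
    _ = Real.exp (y * t) * ∑ ω : LabelChoice n m, choiceWeight p ω *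
        ∏ v, (fun a : Fin m → Bool => if a i = true then Real.exp (-y) else 1) (ω v) := by
        rw [Finset.mul_sum]
        refine Finset.sum_congr rfl fun ω _ => by ring
    _ = Real.exp (y * t) * (1 + (Real.exp (-y) - 1) * p) ^ n := by
        rw [sum_choiceWeight_mul_prod fun _ (a : Fin m → Bool) =>
          if a i = true then Real.exp (-y) else 1]
        simp only [sum_rowWeight_mul_ite, massOf_row_mem]
        simp
    _ ≤ Real.exp (y * t) * (Real.exp (p * (-y + (-y) ^ 2))) ^ n := by
        have hx : 0 ≤ 1 + (Real.exp (-y) - 1) * p := by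
          nlinarith [Real.exp_pos (-y)]
        have := one_add_exp_sub_one_mul_le hy h0
        gcongr
    _ = _ := by
        rw [← Real.exp_nat_mul, ← Real.exp_add]; congr 1; ring

/-- Upper tail of the number of vertices outside `T` with a property that depends on the labels of
the vertices in `T`. -/
theorem massOf_card_filter_notMem_ge (h0 : 0 ≤ p) (h1 : p ≤ 1) (T : Finset (Fin n))
    (G : (T → Fin m → Bool) → Prop) (H : (T → Fin m → Bool) → (Fin m → Bool) → Prop)
    {x y : ℝ} (hx : 0 ≤ x) (hy0 : 0 ≤ y) (hy1 : y ≤ 1)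
    (hG : ∀ τ, G τ → massOf (rowWeight p) (H τ) ≤ x) (t : ℝ) :
    massOf (choiceWeight p) (fun ω : LabelChoice n m => G (fun u => ω u) ∧
      ∃ N : Finset (Fin n), t ≤ N.card ∧ ∀ v ∈ N, v ∉ T ∧ H (fun u => ω u) (ω v)) ≤
      Real.exp (n * x * (y + y ^ 2) - y * t) := by
  classical
  -- Conditioning on the labels `τ` of `T`, written as a sum over `τ`: the product of the `g τ v` is
  -- the indicator that `T` has labels `τ`, and `f` adds the exponential factor at vertices outside
  -- `T`. Both are products over vertices, so their expectations factor.
  set g : (T → Fin m → Bool) → Fin n → (Fin m → Bool) → ℝ :=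
    fun τ v a => if h : v ∈ T then (if a = τ ⟨v, h⟩ then 1 else 0) else 1 with hg
  set f : (T → Fin m → Bool) → Fin n → (Fin m → Bool) → ℝ :=
    fun τ v a => if h : v ∈ T then (if a = τ ⟨v, h⟩ then 1 else 0)
      else if H τ a then Real.exp y else 1 with hf
  have hw := choiceWeight_nonneg (n := n) (m := m) h0 h1
  have hwr := rowWeight_nonneg (m := m) h0 h1
  have hg0 : ∀ τ v a, 0 ≤ g τ v a := fun τ v a => by
    simp only [hg]; split_ifs <;> norm_num
  have hf0 : ∀ τ v a, 0 ≤ f τ v a := fun τ v a => by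
    simp only [hf]; split_ifs <;> positivity
  have hy : |y| ≤ 1 := by rw [abs_le]; constructor <;> linarith
  have hgsum : ∀ ω : LabelChoice n m, ∑ τ, ∏ v, g τ v (ω v) = 1 := by
    intro ω
    rw [Finset.sum_eq_single (fun u : T => ω u)]
    · exact Finset.prod_eq_one fun v _ => by simp [hg]
    · intro τ _ hτ
      obtain ⟨u, hu⟩ := Function.ne_iff.1 hτ
      exact Finset.prod_eq_zero (Finset.mem_univ u.1) (by simp [hg, hu.symm])
    · simp
  set E := Real.exp (x * (y + y ^ 2)) with hE
  have hE1 : 1 ≤ E := by rw [hE, Real.one_le_exp_iff]; positivity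
  have hfg : ∀ τ, G τ → ∏ v, ∑ a, rowWeight p a * f τ v a ≤
      E ^ n * ∏ v, ∑ a, rowWeight p a * g τ v a := by
    intro τ hτ
    have : E ^ n = ∏ v : Fin n, E := by simp
    rw [this, ← Finset.prod_mul_distrib]
    refine Finset.prod_le_prod (fun v _ => Finset.sum_nonneg fun a _ =>
      mul_nonneg (hwr a) (hf0 _ _ _)) fun v _ => ?_
    by_cases hv : v ∈ T
    · simp only [hf, hg, hv, dif_pos]
      refine le_mul_of_one_le_left (Finset.sum_nonneg fun a _ => mul_nonneg (hwr a) ?_) hE1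
      split_ifs <;> norm_num
    · simp only [hf, hg, hv, dif_neg, not_false_eq_true, mul_one, sum_rowWeight_mul_ite,
        sum_rowWeight]
      refine le_trans ?_ (one_add_exp_sub_one_mul_le hy hx)
      have := hG τ hτ
      have : 1 ≤ Real.exp y := by rwa [Real.one_le_exp_iff]
      gcongr
  calc _ ≤ ∑ ω : LabelChoice n m, choiceWeight p ω *
        ∑ τ, (if G τ then Real.exp (-(y * t)) * ∏ v, f τ v (ω v) else 0) := by
        refine massOf_le_sum_mul hw (fun ω => ?_) fun ω hω => ?_
        · refine Finset.sum_nonneg fun τ _ => ?_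
          split_ifs
          · exact mul_nonneg (Real.exp_pos _).le (Finset.prod_nonneg fun v _ => hf0 _ _ _)
          · exact le_rfl
        · obtain ⟨hGω, N, hN, hNH⟩ := hω
          refine le_trans ?_ (Finset.single_le_sum (fun τ _ => ?_)
            (Finset.mem_univ fun u : T => ω u))
          · rw [if_pos hGω]
            have h2 : ∀ v, f (fun u : T => ω u) v (ω v) =
                if v ∉ T ∧ H (fun u : T => ω u) (ω v) then Real.exp y else 1 := by
              intro v
              by_cases hv : v ∈ T <;> simp [hf, hv]
            simp_rw [h2]
            rw [prod_ite_exp_eq, ← Real.exp_add, Real.one_le_exp_iff]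
            have h3 : N ⊆ Finset.univ.filter fun v => v ∉ T ∧ H (fun u : T => ω u) (ω v) :=
              fun v hv => by simpa using hNH v hv
            have h4 : (N.card : ℝ) ≤ _ := Nat.cast_le.2 (Finset.card_le_card h3)
            have h5 := mul_le_mul_of_nonneg_left (hN.trans h4) hy0
            linarith
          · split_ifs
            · exact mul_nonneg (Real.exp_pos _).le (Finset.prod_nonneg fun v _ => hf0 _ _ _)
            · exact le_rfl
    _ = ∑ τ, if G τ then Real.exp (-(y * t)) * ∏ v, ∑ a, rowWeight p a * f τ v a else 0 := by
        simp_rw [Finset.mul_sum]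
        rw [Finset.sum_comm]
        refine Finset.sum_congr rfl fun τ _ => ?_
        split_ifs
        · rw [← sum_choiceWeight_mul_prod, Finset.mul_sum]
          refine Finset.sum_congr rfl fun ω _ => by ring
        · simp
    _ ≤ ∑ τ, Real.exp (-(y * t)) * (E ^ n * ∏ v, ∑ a, rowWeight p a * g τ v a) := by
        refine Finset.sum_le_sum fun τ _ => ?_
        split_ifs with hτ
        · exact mul_le_mul_of_nonneg_left (hfg τ hτ) (Real.exp_pos _).le
        · refine mul_nonneg (Real.exp_pos _).le (mul_nonneg (by positivity)
            (Finset.prod_nonneg fun v _ => Finset.sum_nonneg fun a _ =>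
              mul_nonneg (hwr a) (hg0 _ _ _)))
    _ = Real.exp (-(y * t)) * E ^ n := by
        rw [← Finset.mul_sum, ← Finset.mul_sum]
        simp_rw [← sum_choiceWeight_mul_prod]
        rw [Finset.sum_comm]
        simp_rw [← Finset.mul_sum, hgsum, mul_one, sum_choiceWeight, mul_one]
    _ = _ := by
        rw [hE, ← Real.exp_nat_mul, ← Real.exp_add]; congr 1; ring

/-- From `s! ≥ (s/e)^s` and `e < 3`. It makes the first-moment bounds exponentially small once `s ≥
6 N x`. -/
theorem choose_mul_pow_le {N s : ℕ} (hs : 0 < s) {x : ℝ} (hx : 0 ≤ x) :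
    (N.choose s : ℝ) * x ^ s ≤ (3 * N * x / s) ^ s := by
  have h1 : (N.choose s : ℝ) ≤ (N : ℝ) ^ s / s.factorial := Nat.choose_le_pow_div s N
  have hs' : (0 : ℝ) < s := by exact_mod_cast hs
  have h2 : (s : ℝ) ^ s / s.factorial ≤ 3 ^ s := by
    refine (Real.pow_div_factorial_le_exp (s : ℝ) hs'.le s).trans ?_
    rw [← mul_one (s : ℝ), Real.exp_nat_mul]
    have := Real.exp_one_lt_d9
    gcongr
    linarith
  calc (N.choose s : ℝ) * x ^ s ≤ (N : ℝ) ^ s / s.factorial * x ^ s := by gcongr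
    _ = ((s : ℝ) ^ s / s.factorial) * (N * x / s) ^ s := by
        rw [div_pow, mul_pow]; field_simp
    _ ≤ 3 ^ s * (N * x / s) ^ s := by gcongr
    _ = _ := by rw [← mul_pow]; congr 1; ring

theorem LabelChoice.mem_labelsOf (ω : LabelChoice n m) (v : Fin n) (i : Fin m) :
    i ∈ ω.labelsOf v ↔ ω v i = true := by simp [LabelChoice.labelsOf]

theorem LabelChoice.mem_verticesOf (ω : LabelChoice n m) (v : Fin n) (i : Fin m) :
    v ∈ ω.verticesOf i ↔ ω v i = true := by simp [LabelChoice.verticesOf, LabelChoice.labelsOf]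

theorem massOf_exists_card_labelsOf_ge (h0 : 0 ≤ p) (h1 : p ≤ 1) (s : ℕ) :
    massOf (choiceWeight p) (fun ω : LabelChoice n m => ∃ v, s ≤ (ω.labelsOf v).card) ≤
      n * (m.choose s * p ^ s) := by
  classical
  have hw := choiceWeight_nonneg (n := n) (m := m) h0 h1
  refine (massOf_mono hw (Q := fun ω => ∃ v ∈ (Finset.univ : Finset (Fin n)),
    ∃ X ∈ (Finset.univ : Finset (Fin m)).powersetCard s, ∀ e ∈ ({v} : Finset (Fin n)) ×ˢ X,
      ω e.1 e.2 = true) fun ω => ?_).trans ?_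
  · rintro ⟨v, hv⟩
    obtain ⟨X, hX, hXs⟩ := Finset.exists_subset_card_eq hv
    refine ⟨v, Finset.mem_univ _, X, by simpa using hXs, fun e he => ?_⟩
    simp only [Finset.mem_product, Finset.mem_singleton] at he
    rw [he.1]
    exact (ω.mem_labelsOf _ _).1 (hX he.2)
  · refine (massOf_exists_le_card_mul hw _ _ (x := m.choose s * p ^ s) fun v _ => ?_).trans
      (by simp)
    refine (massOf_exists_le_card_mul hw _ _ (x := p ^ s) fun X hX => ?_).trans (by simp)
    rw [massOf_incidences]
    simp [(Finset.mem_powersetCard.1 hX).2]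

theorem massOf_exists_card_labelsOf_inter_ge (h0 : 0 ≤ p) (h1 : p ≤ 1) (s : ℕ) :
    massOf (choiceWeight p) (fun ω : LabelChoice n m =>
      ∃ u v, u ≠ v ∧ s ≤ (ω.labelsOf u ∩ ω.labelsOf v).card) ≤
      n ^ 2 * (m.choose s * (p ^ 2) ^ s) := by
  classical
  have hw := choiceWeight_nonneg (n := n) (m := m) h0 h1
  refine (massOf_mono hw (Q := fun ω => ∃ d ∈ (Finset.univ : Finset (Fin n)).offDiag,
    ∃ X ∈ (Finset.univ : Finset (Fin m)).powersetCard s,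
      ∀ e ∈ ({d.1, d.2} : Finset (Fin n)) ×ˢ X, ω e.1 e.2 = true) fun ω => ?_).trans ?_
  · rintro ⟨u, v, huv, hv⟩
    obtain ⟨X, hX, hXs⟩ := Finset.exists_subset_card_eq hv
    refine ⟨(u, v), by simpa using huv, X, by simpa using hXs, fun e he => ?_⟩
    simp only [Finset.mem_product, Finset.mem_singleton, Finset.mem_insert] at he
    have := Finset.mem_inter.1 (hX he.2)
    rw [ω.mem_labelsOf, ω.mem_labelsOf] at this
    rcases he.1 with h | h <;> simp [h, this]
  · refine (massOf_exists_le_card_mul hw _ _ (x := m.choose s * (p ^ 2) ^ s) fun d hd => ?_).trans ?_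
    · refine (massOf_exists_le_card_mul hw _ _ (x := (p ^ 2) ^ s) fun X hX => ?_).trans (by simp)
      rw [massOf_incidences]
      simp [(Finset.mem_powersetCard.1 hX).2, Finset.card_pair (Finset.mem_offDiag.1 hd).2.2,
        pow_mul]
    · gcongr
      have : (Finset.univ : Finset (Fin n)).offDiag.card ≤ n ^ 2 := by
        rw [Finset.offDiag_card, sq]; simp
      exact_mod_cast this

theorem massOf_exists_card_verticesOf_inter_ge (h0 : 0 ≤ p) (h1 : p ≤ 1) (s : ℕ) :
    massOf (choiceWeight p) (fun ω : LabelChoice n m =>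
      ∃ i j, i ≠ j ∧ s ≤ (ω.verticesOf i ∩ ω.verticesOf j).card) ≤
      m ^ 2 * (n.choose s * (p ^ 2) ^ s) := by
  classical
  have hw := choiceWeight_nonneg (n := n) (m := m) h0 h1
  refine (massOf_mono hw (Q := fun ω => ∃ d ∈ (Finset.univ : Finset (Fin m)).offDiag,
    ∃ X ∈ (Finset.univ : Finset (Fin n)).powersetCard s,
      ∀ e ∈ X ×ˢ ({d.1, d.2} : Finset (Fin m)), ω e.1 e.2 = true) fun ω => ?_).trans ?_
  · rintro ⟨u, v, huv, hv⟩
    obtain ⟨X, hX, hXs⟩ := Finset.exists_subset_card_eq hv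
    refine ⟨(u, v), by simpa using huv, X, by simpa using hXs, fun e he => ?_⟩
    simp only [Finset.mem_product, Finset.mem_singleton, Finset.mem_insert] at he
    have := Finset.mem_inter.1 (hX he.1)
    rw [ω.mem_verticesOf, ω.mem_verticesOf] at this
    rcases he.2 with h | h <;> simp [h, this]
  · refine (massOf_exists_le_card_mul hw _ _ (x := n.choose s * (p ^ 2) ^ s) fun d hd => ?_).trans ?_
    · refine (massOf_exists_le_card_mul hw _ _ (x := (p ^ 2) ^ s) fun X hX => ?_).trans (by simp)
      rw [massOf_incidences]
      simp [(Finset.mem_powersetCard.1 hX).2, Finset.card_pair (Finset.mem_offDiag.1 hd).2.2,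
        pow_mul, mul_comm s]
    · gcongr
      have : (Finset.univ : Finset (Fin m)).offDiag.card ≤ m ^ 2 := by
        rw [Finset.offDiag_card, sq]; simp
      exact_mod_cast this

/-- Triangles whose three edges come from three different labels. -/
theorem massOf_exists_multilabel_triangle (h0 : 0 ≤ p) (h1 : p ≤ 1) :
    massOf (choiceWeight p) (fun ω : LabelChoice n m => ∃ u v w : Fin n, ∃ i j k : Fin m,
      (u ≠ v ∧ v ≠ w ∧ u ≠ w) ∧ (i ≠ j ∧ j ≠ k ∧ i ≠ k) ∧
      (ω u i = true ∧ ω v i = true) ∧ (ω v j = true ∧ ω w j = true) ∧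
      (ω u k = true ∧ ω w k = true)) ≤ (n * m * p ^ 2) ^ 3 := by
  classical
  have hw := choiceWeight_nonneg (n := n) (m := m) h0 h1
  let C : Finset ((Fin n × Fin n × Fin n) × (Fin m × Fin m × Fin m)) := Finset.univ.filter
    fun d => (d.1.1 ≠ d.1.2.1 ∧ d.1.2.1 ≠ d.1.2.2 ∧ d.1.1 ≠ d.1.2.2) ∧
      (d.2.1 ≠ d.2.2.1 ∧ d.2.2.1 ≠ d.2.2.2 ∧ d.2.1 ≠ d.2.2.2)
  let I : (Fin n × Fin n × Fin n) × (Fin m × Fin m × Fin m) → Finset (Fin n × Fin m) := fun d =>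
    {(d.1.1, d.2.1), (d.1.2.1, d.2.1), (d.1.2.1, d.2.2.1), (d.1.2.2, d.2.2.1), (d.1.1, d.2.2.2),
      (d.1.2.2, d.2.2.2)}
  refine (massOf_mono hw (Q := fun ω => ∃ d ∈ C, ∀ e ∈ I d, ω e.1 e.2 = true)
    fun ω => ?_).trans ?_
  · rintro ⟨u, v, w, i, j, k, hu, hi, h⟩
    refine ⟨((u, v, w), (i, j, k)), ?_, ?_⟩
    · simp only [C, Finset.mem_filter, Finset.mem_univ, true_and]
      exact ⟨hu, hi⟩
    · simp only [I, Finset.mem_insert, Finset.mem_singleton]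
      rintro e (rfl | rfl | rfl | rfl | rfl | rfl) <;> simp [h]
  · refine (massOf_exists_le_card_mul hw _ _ (x := p ^ 6) fun d hd => ?_).trans ?_
    · rw [massOf_incidences]
      simp only [C, Finset.mem_filter, Finset.mem_univ, true_and] at hd
      obtain ⟨⟨a1, a2, a3⟩, b1, b2, b3⟩ := hd
      have : (I d).card = 6 := by
        simp only [I]
        repeat rw [Finset.card_insert_of_notMem]
        · simp
        all_goals simp [a1, a2, a3, b1, b2, b3, a1.symm, a3.symm]
      rw [this]
    · have : C.card ≤ (n * m) ^ 3 := by
        refine (Finset.card_le_univ C).trans (le_of_eq ?_)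
        simp only [Fintype.card_prod, Fintype.card_fin]
        ring
      have h3 : (C.card : ℝ) ≤ (n * m) ^ 3 := by exact_mod_cast this
      calc (C.card : ℝ) * p ^ 6 ≤ (n * m) ^ 3 * p ^ 6 := by gcongr
        _ = _ := by ring

end tails

/-! ### Choosing a spread-out subset by conditional expectations -/

/-- A set of `k` points that is spread out over a family of properties each of which holds for at
most two thirds of the available points. -/
theorem exists_subset_sum_two_pow_le {V L : Type*} [DecidableEq V] (Q : Finset V) (J : Finset L)
    (R : L → V → Prop) [∀ j, DecidablePred (R j)] (k : ℕ)
    (h : ∀ U ⊆ Q, U.card < k → (Q \ U).Nonempty ∧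
      ∀ j ∈ J, 3 * ((Q \ U).filter (R j)).card ≤ 2 * (Q \ U).card) :
    ∃ T ⊆ Q, T.card = k ∧ 3 ^ k * ∑ j ∈ J, 2 ^ (T.filter (R j)).card ≤ J.card * 5 ^ k := by
  induction k with
  | zero => exact ⟨∅, by simp, by simp, by simp⟩
  | succ k ih =>
    obtain ⟨T, hTQ, hTk, hT⟩ := ih fun U hU hUk => h U hU (by omega)
    obtain ⟨hne, hR⟩ := h T hTQ (by omega)
    -- Adding `u` doubles the terms whose property holds at `u`. Averaged over the available `u`,
    -- each term grows by a factor of at most `1 + 2/3 = 5/3`, so some `u` does no worse than that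
    -- for the whole sum.
    have hstep : ∃ u ∈ Q \ T, 3 * ∑ j ∈ J, 2 ^ ((insert u T).filter (R j)).card ≤
        5 * ∑ j ∈ J, 2 ^ (T.filter (R j)).card := by
      refine Finset.exists_le_of_sum_le hne ?_
      have h1 : ∀ u ∈ Q \ T, ∀ j, 2 ^ ((insert u T).filter (R j)).card =
          2 ^ (T.filter (R j)).card * (1 + if R j u then 1 else 0) := by
        intro u hu j
        rw [Finset.filter_insert]
        split_ifs
        · rw [Finset.card_insert_of_notMem (by simp [(Finset.mem_sdiff.1 hu).2]), pow_succ]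
        · simp
      calc ∑ u ∈ Q \ T, 3 * ∑ j ∈ J, 2 ^ ((insert u T).filter (R j)).card
          = ∑ u ∈ Q \ T, 3 * ∑ j ∈ J, 2 ^ (T.filter (R j)).card * (1 + if R j u then 1 else 0) :=
            Finset.sum_congr rfl fun u hu => by simp_rw [h1 u hu]
        _ = ∑ j ∈ J, 2 ^ (T.filter (R j)).card *
              (3 * (Q \ T).card + 3 * ((Q \ T).filter (R j)).card) := by
            rw [← Finset.mul_sum, Finset.sum_comm, Finset.mul_sum]
            refine Finset.sum_congr rfl fun j _ => ?_
            rw [← Finset.mul_sum, Finset.sum_add_distrib, Finset.card_filter]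
            simp; ring
        _ ≤ ∑ j ∈ J, 2 ^ (T.filter (R j)).card * (5 * (Q \ T).card) := by
            refine Finset.sum_le_sum fun j hj => Nat.mul_le_mul_left _ ?_
            have := hR j hj
            omega
        _ = _ := by
            rw [← Finset.sum_mul]; simp; ring
    obtain ⟨u, hu, hle⟩ := hstep
    rw [Finset.mem_sdiff] at hu
    refine ⟨insert u T, Finset.insert_subset hu.1 hTQ, by simp [hu.2, hTk], ?_⟩
    calc 3 ^ (k + 1) * ∑ j ∈ J, 2 ^ ((insert u T).filter (R j)).card
        = 3 ^ k * (3 * ∑ j ∈ J, 2 ^ ((insert u T).filter (R j)).card) := by ring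
      _ ≤ 3 ^ k * (5 * ∑ j ∈ J, 2 ^ (T.filter (R j)).card) := Nat.mul_le_mul_left _ hle
      _ = 5 * (3 ^ k * ∑ j ∈ J, 2 ^ (T.filter (R j)).card) := by ring
      _ ≤ 5 * (J.card * 5 ^ k) := Nat.mul_le_mul_left _ hT
      _ = _ := by ring

/-- If a property failed at fewer than `b` points of `T`, its term alone would be at least
`2^(9b+1)`, above the bound `3^b (5/3)^(10b)`. The factor 10 works because `5^10 ≤ 6^9`. -/
theorem exists_subset_card_filter_not_ge {V L : Type*} [DecidableEq V] (Q : Finset V)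
    (J : Finset L) (R : L → V → Prop) [∀ j, DecidablePred (R j)] (b : ℕ) (hJ : J.card ≤ 3 ^ b)
    (h : ∀ U ⊆ Q, U.card < 10 * b → (Q \ U).Nonempty ∧
      ∀ j ∈ J, 3 * ((Q \ U).filter (R j)).card ≤ 2 * (Q \ U).card) :
    ∃ T ⊆ Q, T.card = 10 * b ∧ ∀ j ∈ J, b ≤ (T.filter fun u => ¬ R j u).card := by
  obtain ⟨T, hTQ, hTk, hT⟩ := exists_subset_sum_two_pow_le Q J R (10 * b) h
  refine ⟨T, hTQ, hTk, fun j hj => ?_⟩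
  by_contra! hlt
  have h1 := Finset.card_filter_add_card_filter_not (s := T) (R j)
  have h2 : 9 * b + 1 ≤ (T.filter (R j)).card := by omega
  have h3 : 2 ^ (9 * b + 1) ≤ ∑ j ∈ J, 2 ^ (T.filter (R j)).card :=
    (Nat.pow_le_pow_right (by norm_num) h2).trans
      (Finset.single_le_sum (f := fun j => 2 ^ (T.filter (R j)).card) (fun _ _ => Nat.zero_le _) hj)
  have h4 : 3 ^ (10 * b) * 2 ^ (9 * b + 1) ≤ 3 ^ b * 5 ^ (10 * b) :=
    (Nat.mul_le_mul_left _ h3).trans (hT.trans (Nat.mul_le_mul_right _ hJ))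
  have h5 : 3 ^ (10 * b) * 2 ^ (9 * b + 1) = 3 ^ b * ((6 ^ 9) ^ b * 2) := by
    rw [show (6 : ℕ) = 3 * 2 by norm_num, mul_pow, mul_pow, ← pow_mul, ← pow_mul, pow_succ,
      show 10 * b = b + 9 * b by ring, pow_add]
    ring
  rw [h5, pow_mul] at h4
  have h6 := Nat.le_of_mul_le_mul_left h4 (by positivity)
  have h7 : (5 ^ 10) ^ b ≤ (6 ^ 9) ^ b := Nat.pow_le_pow_left (by norm_num) b
  have h8 : 0 < (6 ^ 9) ^ b := by positivity
  omega

/-! ### Deterministic structure of cliques not covered by one label -/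

namespace LabelChoice

variable {n m : ℕ}

theorem exists_common_label {ω : LabelChoice n m} {Q : Finset (Fin n)}
    (hQ : ω.intersectionGraph.IsClique (Q : Set (Fin n))) {u v : Fin n} (hu : u ∈ Q) (hv : v ∈ Q)
    (huv : u ≠ v) : ∃ i, ω u i = true ∧ ω v i = true := by
  obtain ⟨-, i, hi⟩ := hQ hu hv huv
  rw [Finset.mem_inter, ω.mem_labelsOf, ω.mem_labelsOf] at hi
  exact ⟨i, hi⟩

/-- A label covering as many vertices of the clique `Q` as possible. -/
theorem exists_label_card_inter_max {ω : LabelChoice n m} {Q : Finset (Fin n)}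
    (hQ : ω.intersectionGraph.IsClique (Q : Set (Fin n))) (h2 : 2 ≤ Q.card) :
    ∃ i, (∀ j, (Q.filter fun v => ω v j = true).card ≤ (Q.filter fun v => ω v i = true).card) ∧
      (Q.filter fun v => ω v i = true).Nonempty := by
  obtain ⟨u, hu, v, hv, huv⟩ := Finset.one_lt_card.1 h2
  obtain ⟨l, hl, -⟩ := exists_common_label hQ hu hv huv
  have : Nonempty (Fin m) := ⟨l⟩
  obtain ⟨i, hi⟩ := Finite.exists_max fun j => (Q.filter fun v => ω v j = true).card
  refine ⟨i, hi, Finset.card_pos.1 (lt_of_lt_of_le ?_ (hi l))⟩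
  exact Finset.card_pos.2 ⟨u, by simp [hu, hl]⟩

theorem exists_notMem_of_not_formedBySingleLabel {ω : LabelChoice n m} {Q : Finset (Fin n)}
    (hns : ¬ ω.FormedBySingleLabel Q) (i : Fin m) : ∃ v ∈ Q, ω v i = false := by
  simp only [FormedBySingleLabel, not_exists, Finset.not_subset] at hns
  obtain ⟨v, hv, h⟩ := hns i
  rw [ω.mem_verticesOf] at h
  exact ⟨v, hv, by simpa using h⟩

/-- Take a label `j` covering most vertices of `Q`, a vertex `u` without `j`, and a vertex `v` with
`j`, joined to `u` by a label `i`. By maximality of `j` some vertex `w` has `j` but not `i`, and the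
edge `uw` needs a third label. -/
theorem exists_multilabel_triangle {ω : LabelChoice n m} {Q : Finset (Fin n)}
    (hQ : ω.intersectionGraph.IsClique (Q : Set (Fin n))) (h2 : 2 ≤ Q.card)
    (hns : ¬ ω.FormedBySingleLabel Q) :
    ∃ u v w : Fin n, ∃ i j k : Fin m,
      (u ≠ v ∧ v ≠ w ∧ u ≠ w) ∧ (i ≠ j ∧ j ≠ k ∧ i ≠ k) ∧
      (ω u i = true ∧ ω v i = true) ∧ (ω v j = true ∧ ω w j = true) ∧
      (ω u k = true ∧ ω w k = true) := by
  obtain ⟨j, hmax, v, hv⟩ := exists_label_card_inter_max hQ h2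
  obtain ⟨u, huQ, huj⟩ := exists_notMem_of_not_formedBySingleLabel hns j
  rw [Finset.mem_filter] at hv
  have hne : ∀ x, ω x j = true → u ≠ x := by
    rintro x hx rfl
    simp [hx] at huj
  obtain ⟨i, hui, hvi⟩ := exists_common_label hQ huQ hv.1 (hne v hv.2)
  -- Otherwise `i` would cover every vertex of `Q` that `j` covers, and `u` besides.
  have hw : ∃ w ∈ Q, ω w j = true ∧ ω w i = false := by
    by_contra! h
    refine absurd (hmax i) (not_le.2 (Finset.card_lt_card ?_))
    refine Finset.ssubset_iff_subset_ne.2 ⟨fun w hw => ?_, fun heq => ?_⟩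
    · rw [Finset.mem_filter] at hw ⊢
      exact ⟨hw.1, by simpa using h w hw.1 hw.2⟩
    · have : u ∈ Q.filter fun v => ω v j = true := by rw [heq]; simp [huQ, hui]
      simp [huj] at this
  obtain ⟨w, hwQ, hwj, hwi⟩ := hw
  obtain ⟨k, huk, hwk⟩ := exists_common_label hQ huQ hwQ (hne w hwj)
  refine ⟨u, v, w, i, j, k, ⟨hne v hv.2, ?_, hne w hwj⟩, ⟨?_, ?_, ?_⟩, ⟨hui, hvi⟩, ⟨hv.2, hwj⟩,
    huk, hwk⟩
  · rintro rfl; simp [hwi] at hvi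
  · rintro rfl; simp [hui] at huj
  · rintro rfl; simp [huk] at huj
  · rintro rfl; simp [hwi] at hwk

/-- A clique not formed by a single label has a small subset witnessing this robustly. -/
theorem exists_spread_subset {ω : LabelChoice n m} {Q : Finset (Fin n)}
    (hQ : ω.intersectionGraph.IsClique (Q : Set (Fin n))) (h2 : 2 ≤ Q.card)
    (hns : ¬ ω.FormedBySingleLabel Q) {b : ℕ} (hm : m ≤ 3 ^ b)
    (hr : ∀ i j, i ≠ j → 4 * (ω.verticesOf i ∩ ω.verticesOf j).card ≤ Q.card)
    (hb : 16 * (10 * b + 1) ≤ Q.card) :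
    ∃ T : Finset (Fin n), ∃ v i, v ∉ T ∧ insert v T ⊆ Q ∧ T.card = 10 * b ∧ ω v i = false ∧
      ∀ j, j ≠ i → b ≤ (T.filter fun u => j ∉ ω.labelsOf u).card := by
  classical
  obtain ⟨i, hmax, -⟩ := exists_label_card_inter_max hQ h2
  obtain ⟨v, hvQ, hvi⟩ := exists_notMem_of_not_formedBySingleLabel hns i
  -- Twice the part covered by `j` is at most the parts covered by `i` and `j` together, hence at
  -- most `|Q| + |Q|/4`. The slack between 5/8 and 2/3 allows for the at most `10 b` vertices
  -- removed in the greedy choice.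
  have hfew : ∀ j, j ≠ i → 8 * (Q.filter fun v => ω v j = true).card ≤ 5 * Q.card := by
    intro j hj
    have h1 := Finset.card_union_add_card_inter (Q.filter fun v => ω v j = true)
      (Q.filter fun v => ω v i = true)
    have h2 : ((Q.filter fun v => ω v j = true) ∪ Q.filter fun v => ω v i = true).card ≤ Q.card :=
      Finset.card_le_card (Finset.union_subset (Finset.filter_subset _ _)
        (Finset.filter_subset _ _))
    have h3 : ((Q.filter fun v => ω v j = true) ∩ Q.filter fun v => ω v i = true).card ≤
        (ω.verticesOf j ∩ ω.verticesOf i).card := by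
      refine Finset.card_le_card fun w hw => ?_
      simp only [Finset.mem_inter, Finset.mem_filter, ω.mem_verticesOf] at hw ⊢
      exact ⟨hw.1.2, hw.2.2⟩
    have h4 := hr j i hj
    have h5 := hmax j
    omega
  obtain ⟨T, hTQ, hTb, hT⟩ := exists_subset_card_filter_not_ge (Q.erase v)
    ((Finset.univ : Finset (Fin m)).erase i) (fun j u => ω u j = true) b
    ((Finset.card_erase_le).trans (by simpa using hm)) fun U hU hUb => by
      have h1 : (Q.erase v \ U).card = Q.card - 1 - U.card := by
        rw [Finset.card_sdiff_of_subset hU, Finset.card_erase_of_mem hvQ]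
      refine ⟨Finset.card_pos.1 (by omega), fun j hj => ?_⟩
      have h2 := hfew j (Finset.ne_of_mem_erase hj)
      have h3 : ((Q.erase v \ U).filter fun u => ω u j = true).card ≤
          (Q.filter fun v => ω v j = true).card :=
        Finset.card_le_card (Finset.filter_subset_filter _
          (Finset.sdiff_subset.trans (Finset.erase_subset _ _)))
      omega
  refine ⟨T, v, i, fun h => by simpa using hTQ h,
    Finset.insert_subset hvQ (hTQ.trans (Finset.erase_subset _ _)), hTb, hvi, fun j hj => ?_⟩
  have := hT j (by simpa using hj)
  simpa only [ω.mem_labelsOf] using this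

end LabelChoice

/-! ### Large deviations for common neighbours of a spread-out set -/

theorem exp_neg_two_mul_le_one_sub {p : ℝ} (h0 : 0 ≤ p) (h : p ≤ 1 / 2) :
    Real.exp (-2 * p) ≤ 1 - p := by
  have h1 := Real.add_one_le_exp (2 * p)
  rw [show -2 * p = -(2 * p) by ring, Real.exp_neg, inv_le_comm₀ (Real.exp_pos _) (by linarith)]
  refine le_trans ?_ h1
  rw [inv_le_iff_one_le_mul₀ (by linarith)]
  nlinarith

theorem half_pow_le_exp (b : ℕ) : (1 / 2 : ℝ) ^ b ≤ Real.exp (-(b / 2 : ℝ)) := by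
  have h : (1 / 2 : ℝ) ≤ Real.exp (-(1 / 2)) := by
    have := Real.add_one_le_exp (-(1 / 2) : ℝ)
    linarith
  calc (1 / 2 : ℝ) ^ b ≤ Real.exp (-(1 / 2)) ^ b := by gcongr
    _ = _ := by rw [← Real.exp_nat_mul]; congr 1; ring

/-- The conditional step: the probability that the vertices of `insert v T` have many common
neighbours although their labels are spread out. -/
theorem massOf_many_common_neighbours_le {n m b s : ℕ} {p κ : ℝ} (h0 : 0 < p) (h1 : p ≤ 1)
    (hκ0 : 0 < κ) (hκ1 : κ ≤ 1) (hs : κ ≤ (1 - p) ^ s)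
    (hM : ((10 * b : ℝ) ^ 2 * b) ^ 2 * p ≤ κ / 4) (hrest : (m + 1) * (1 - κ) ^ b ≤ κ / 4 * p)
    (T : Finset (Fin n)) (v : Fin n) (hT : T.card = 10 * b) :
    massOf (choiceWeight p) (fun ω : LabelChoice n m =>
      (∀ u, (ω.labelsOf u).card ≤ s) ∧
      (∀ u w, u ≠ w → (ω.labelsOf u ∩ ω.labelsOf w).card ≤ b) ∧
      (∃ i, ω v i = false ∧ ∀ j, j ≠ i → b ≤ (T.filter fun u => j ∉ ω.labelsOf u).card) ∧
      ∃ N : Finset (Fin n), (1 - κ / 4) * (n * p) ≤ N.card ∧ ∀ x ∈ N, x ∉ insert v T ∧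
        ∀ u ∈ insert v T, ∃ j ∈ ω.labelsOf u, ω x j = true) ≤
      Real.exp (-(κ ^ 2 / 64 * (n * p))) := by
  classical
  let S : ({u // u ∈ insert v T} → Fin m → Bool) → Fin n → Finset (Fin m) := fun τ u =>
    if h : u ∈ insert v T then Finset.univ.filter fun j => τ ⟨u, h⟩ j = true else ∅
  have hS : ∀ ω : LabelChoice n m, ∀ u ∈ insert v T,
      S (fun u => ω u) u = ω.labelsOf u := by
    intro ω u hu
    simp only [S, hu, dif_pos]
    rfl
  let G : ({u // u ∈ insert v T} → Fin m → Bool) → Prop := fun τ =>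
    (∀ u ∈ insert v T, (S τ u).card ≤ s) ∧
    (∀ u ∈ T, ∀ w ∈ T, u ≠ w → (S τ u ∩ S τ w).card ≤ b) ∧
    ∃ i, i ∉ S τ v ∧ ∀ j, j ≠ i → b ≤ (T.filter fun u => j ∉ S τ u).card
  -- The probability for a fresh vertex: `(1 - κ) p` for the label `i`, plus `κ p / 4` for each of
  -- the two error terms.
  have hx : 0 ≤ (1 - κ / 2) * p := mul_nonneg (by linarith) h0.le
  -- The exponent `y = κ/8` is half the gap between `1 - κ/2` and `1 - κ/4`.
  refine (massOf_mono (choiceWeight_nonneg h0.le h1) fun ω hω => ?_).trans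
    ((massOf_card_filter_notMem_ge h0.le h1 (insert v T) G
      (fun τ a => ∀ u ∈ insert v T, ∃ j ∈ S τ u, a j = true) hx (y := κ / 8) (by linarith)
      (by linarith) (fun τ hτ => ?_) ((1 - κ / 4) * (n * p))).trans ?_)
  · obtain ⟨ha, hb, ⟨i, hi, hj⟩, N, hN, hNx⟩ := hω
    refine ⟨⟨fun u hu => ?_, fun u hu w hw huw => ?_, i, ?_, fun j hji => ?_⟩, N, hN,
      fun x hx => ⟨(hNx x hx).1, fun u hu => ?_⟩⟩
    · rw [hS ω u hu]; exact ha u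
    · rw [hS ω u (Finset.mem_insert_of_mem hu), hS ω w (Finset.mem_insert_of_mem hw)]
      exact hb u w huw
    · rw [hS ω v (Finset.mem_insert_self _ _), ω.mem_labelsOf]; simp [hi]
    · rw [Finset.filter_congr fun u hu => by rw [hS ω u (Finset.mem_insert_of_mem hu)]]
      exact hj j hji
    · rw [hS ω u hu]; exact (hNx x hx).2 u hu
  · obtain ⟨ha, hb', i, hi, hj⟩ := hτ
    refine (massOf_row_hits_le h0.le h1 (S τ) T v i s b b hi (ha v (Finset.mem_insert_self _ _))
      (fun u hu => ha u (Finset.mem_insert_of_mem hu)) hb' hj (by omega)).trans ?_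
    rw [hT]
    push_cast
    have e1 : p * (1 - (1 - p) ^ s) ≤ p * (1 - κ) := by gcongr
    have hps : (1 - p) ^ s ≤ 1 := pow_le_one₀ (by linarith) (by linarith)
    have e2 : ((m : ℝ) + 1) * (1 - (1 - p) ^ s) ^ b ≤ (m + 1) * (1 - κ) ^ b := by
      have : (1 - (1 - p) ^ s) ^ b ≤ (1 - κ) ^ b :=
        pow_le_pow_left₀ (by linarith) (by linarith) b
      gcongr
    have e3 : ((10 * b : ℝ) ^ 2 * b) ^ 2 * p ^ 2 ≤ κ / 4 * p := by
      rw [pow_two p, ← mul_assoc]; gcongr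
    nlinarith
  · rw [Real.exp_le_exp]
    have hnp : 0 ≤ (n : ℝ) * p := by positivity
    have : (n : ℝ) * ((1 - κ / 2) * p) * (κ / 8 + (κ / 8) ^ 2) - κ / 8 * ((1 - κ / 4) * (n * p)) =
        n * p * (-(κ ^ 2 / 64) - κ ^ 3 / 128) := by ring
    rw [this]
    have : 0 ≤ (n : ℝ) * p * (κ ^ 3 / 128) := by positivity
    linarith

/-- There are a set `T` of `10 * b` vertices and a vertex `v` such that the labels of `insert v T`
are spread out and at least `t` further vertices share a label with every vertex of
`insert v T`. -/
def LabelChoice.HasManyCommonNeighbours {n m : ℕ} (ω : LabelChoice n m) (s b : ℕ) (t : ℝ) : Prop :=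
  ∃ T : Finset (Fin n), ∃ v,
    T.card = 10 * b ∧ (∀ u, (ω.labelsOf u).card ≤ s) ∧
    (∀ u w, u ≠ w → (ω.labelsOf u ∩ ω.labelsOf w).card ≤ b) ∧
    (∃ i, ω v i = false ∧ ∀ j, j ≠ i → b ≤ (T.filter fun u => j ∉ ω.labelsOf u).card) ∧
    ∃ N : Finset (Fin n), t ≤ N.card ∧ ∀ x ∈ N, x ∉ insert v T ∧
      ∀ u ∈ insert v T, ∃ j ∈ ω.labelsOf u, ω x j = true

/-! ### Explicit bounds in the dense case -/

section bounds

variable {n m b : ℕ} {p c κ : ℝ}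

/-- The mean size of a label set is `mp ≤ c/p`; six times `c/p` is where the first-moment base drops
to 1/2. -/
theorem massOf_exists_card_labelsOf_ge_ceil (hp0 : 0 < p) (hp1 : p ≤ 1) (hc : 1 ≤ c)
    (hmp : m * p ^ 2 ≤ c) (hpb : p * b ≤ 1) :
    massOf (choiceWeight p) (fun ω : LabelChoice n m =>
      ∃ v, ⌈6 * c / p⌉₊ ≤ (ω.labelsOf v).card) ≤ n * (1 / 2) ^ b := by
  have hx : 6 * c / p ≤ ⌈6 * c / p⌉₊ := Nat.le_ceil _
  have hpos : 0 < 6 * c / p := by positivity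
  have hs : 0 < ⌈6 * c / p⌉₊ := Nat.ceil_pos.2 hpos
  have hbs : b ≤ ⌈6 * c / p⌉₊ := by
    have : (b : ℝ) ≤ 6 * c / p := by
      rw [le_div_iff₀ hp0]; linarith
    exact_mod_cast this.trans hx
  refine (massOf_exists_card_labelsOf_ge hp0.le hp1 _).trans ?_
  have h1 : 3 * (m : ℝ) * p / ⌈6 * c / p⌉₊ ≤ 1 / 2 := by
    rw [div_le_iff₀ (by exact_mod_cast hs)]
    have : 3 * (m : ℝ) * p ≤ 1 / 2 * (6 * c / p) := by
      rw [show 1 / 2 * (6 * c / p) = 3 * c / p by ring, le_div_iff₀ hp0]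
      nlinarith
    linarith
  have h2 : (3 * (m : ℝ) * p / ⌈6 * c / p⌉₊) ^ ⌈6 * c / p⌉₊ ≤ (1 / 2) ^ ⌈6 * c / p⌉₊ :=
    pow_le_pow_left₀ (by positivity) h1 _
  have h3 : (1 / 2 : ℝ) ^ ⌈6 * c / p⌉₊ ≤ (1 / 2) ^ b :=
    pow_le_pow_of_le_one (by norm_num) (by norm_num) hbs
  have := choose_mul_pow_le (N := m) hs hp0.le
  gcongr
  linarith

theorem massOf_exists_card_labelsOf_inter_ge_half_pow (hp0 : 0 < p) (hp1 : p ≤ 1) (hb : 1 ≤ b)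
    (hmp : m * p ^ 2 ≤ c) (hcb : 6 * c ≤ b) :
    massOf (choiceWeight p) (fun ω : LabelChoice n m =>
      ∃ u v, u ≠ v ∧ b ≤ (ω.labelsOf u ∩ ω.labelsOf v).card) ≤ n ^ 2 * (1 / 2) ^ b := by
  refine (massOf_exists_card_labelsOf_inter_ge hp0.le hp1 _).trans ?_
  have h1 : 3 * (m : ℝ) * p ^ 2 / b ≤ 1 / 2 := by
    rw [div_le_iff₀ (by exact_mod_cast hb)]
    linarith
  have h2 : (3 * (m : ℝ) * p ^ 2 / b) ^ b ≤ (1 / 2) ^ b := pow_le_pow_left₀ (by positivity) h1 _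
  have := choose_mul_pow_le (N := m) (s := b) hb (sq_nonneg p)
  gcongr
  linarith

theorem massOf_exists_card_verticesOf_inter_ge_ceil (hp0 : 0 < p) (hp1 : 96 * p ≤ 1)
    (hb : 1 ≤ b) (hnp : 16 * b ≤ n * p) :
    massOf (choiceWeight p) (fun ω : LabelChoice n m =>
      ∃ i j, i ≠ j ∧ ⌈n * p / 16⌉₊ ≤ (ω.verticesOf i ∩ ω.verticesOf j).card) ≤
      m ^ 2 * (1 / 2) ^ b := by
  have hx : n * p / 16 ≤ ⌈n * p / 16⌉₊ := Nat.le_ceil _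
  have hbs : b ≤ ⌈n * p / 16⌉₊ := by
    have : (b : ℝ) ≤ n * p / 16 := by linarith
    exact_mod_cast this.trans hx
  have hs : 0 < ⌈n * p / 16⌉₊ := by omega
  refine (massOf_exists_card_verticesOf_inter_ge hp0.le (by linarith) _).trans ?_
  have h1 : 3 * (n : ℝ) * p ^ 2 / ⌈n * p / 16⌉₊ ≤ 1 / 2 := by
    rw [div_le_iff₀ (by exact_mod_cast hs)]
    have : 0 ≤ (n : ℝ) * p := by positivity
    nlinarith
  have h2 : (3 * (n : ℝ) * p ^ 2 / ⌈n * p / 16⌉₊) ^ ⌈n * p / 16⌉₊ ≤ (1 / 2) ^ ⌈n * p / 16⌉₊ :=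
    pow_le_pow_left₀ (by positivity) h1 _
  have h3 : (1 / 2 : ℝ) ^ ⌈n * p / 16⌉₊ ≤ (1 / 2) ^ b :=
    pow_le_pow_of_le_one (by norm_num) (by norm_num) hbs
  have := choose_mul_pow_le (N := n) hs (sq_nonneg p)
  gcongr
  linarith

theorem massOf_exists_many_common_neighbours_le {s : ℕ} (h0 : 0 < p) (h1 : p ≤ 1)
    (hκ0 : 0 < κ) (hκ1 : κ ≤ 1) (hs : κ ≤ (1 - p) ^ s)
    (hM : ((10 * b : ℝ) ^ 2 * b) ^ 2 * p ≤ κ / 4) (hrest : (m + 1) * (1 - κ) ^ b ≤ κ / 4 * p) :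
    massOf (choiceWeight p) (fun ω : LabelChoice n m => ω.HasManyCommonNeighbours s b ((1 - κ / 4) * (n * p))) ≤
      n ^ (10 * b + 1) * Real.exp (-(κ ^ 2 / 64 * (n * p))) := by
  classical
  have hw := choiceWeight_nonneg (n := n) (m := m) h0.le h1
  refine (massOf_mono hw (Q := fun ω => ∃ d ∈ (Finset.univ : Finset (Fin n)).powersetCard (10 * b)
    ×ˢ (Finset.univ : Finset (Fin n)), (∀ u, (ω.labelsOf u).card ≤ s) ∧
      (∀ u w, u ≠ w → (ω.labelsOf u ∩ ω.labelsOf w).card ≤ b) ∧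
      (∃ i, ω d.2 i = false ∧ ∀ j, j ≠ i → b ≤ (d.1.filter fun u => j ∉ ω.labelsOf u).card) ∧
      ∃ N : Finset (Fin n), (1 - κ / 4) * (n * p) ≤ N.card ∧ ∀ x ∈ N, x ∉ insert d.2 d.1 ∧
        ∀ u ∈ insert d.2 d.1, ∃ j ∈ ω.labelsOf u, ω x j = true) fun ω => ?_).trans
    ((massOf_exists_le_card_mul hw _ _ (x := Real.exp (-(κ ^ 2 / 64 * (n * p))))
      fun d hd => ?_).trans ?_)
  · rintro ⟨T, v, hT, h⟩
    exact ⟨(T, v), by simp [hT], h⟩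
  · simp only [Finset.mem_product, Finset.mem_powersetCard] at hd
    exact massOf_many_common_neighbours_le h0 h1 hκ0 hκ1 hs hM hrest d.1 d.2 hd.1.2
  · gcongr
    have : n.choose (10 * b) ≤ n ^ (10 * b) := Nat.choose_le_pow n (10 * b)
    rw [Finset.card_product, Finset.card_powersetCard, pow_succ]
    simp only [Finset.card_univ, Fintype.card_fin]
    exact_mod_cast Nat.mul_le_mul_right n this

/-- Outside the three exceptional events the spread subset exists, and the rest of `Q` consists of
its common neighbours. Weakening `1 - κ/8` to `1 - κ/4` pays for the `10 b + 1` vertices removed. -/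
theorem LabelChoice.hasManyCommonNeighbours_of_isClique {ω : LabelChoice n m} {s : ℕ}
    {Q : Finset (Fin n)} (hκ0 : 0 < κ) (hκ1 : κ ≤ 1 / 8) (hb200 : (200 : ℝ) ≤ b)
    (hb2 : 40000 ≤ κ * b ^ 2) (hnp : (b : ℝ) ^ 3 ≤ n * p) (hnp' : 40000 * (b : ℝ) ≤ n * p)
    (hm3 : m ≤ 3 ^ b) (hQ : ω.intersectionGraph.IsClique (Q : Set (Fin n))) (h2 : 2 ≤ Q.card)
    (hQt : (1 - κ / 8) * (n * p) ≤ Q.card) (hns : ¬ ω.FormedBySingleLabel Q) :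
    (((∃ v, s ≤ (ω.labelsOf v).card) ∨
      ∃ u v, u ≠ v ∧ b ≤ (ω.labelsOf u ∩ ω.labelsOf v).card) ∨
      ∃ i j, i ≠ j ∧ ⌈n * p / 16⌉₊ ≤ (ω.verticesOf i ∩ ω.verticesOf j).card) ∨
    ω.HasManyCommonNeighbours s b ((1 - κ / 4) * (n * p)) := by
  classical
  by_cases hA : ∃ v, s ≤ (ω.labelsOf v).card
  · exact Or.inl (Or.inl (Or.inl hA))
  by_cases hB : ∃ u v, u ≠ v ∧ b ≤ (ω.labelsOf u ∩ ω.labelsOf v).card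
  · exact Or.inl (Or.inl (Or.inr hB))
  by_cases hC : ∃ i j, i ≠ j ∧ ⌈n * p / 16⌉₊ ≤ (ω.verticesOf i ∩ ω.verticesOf j).card
  · exact Or.inl (Or.inr hC)
  refine Or.inr ?_
  push Not at hA hB hC
  have hQhalf : n * p / 2 ≤ (Q.card : ℝ) := by nlinarith
  obtain ⟨T, v, i, hvT, hTQ, hT, hvi, hj⟩ := LabelChoice.exists_spread_subset hQ h2 hns hm3
    (fun i j hij => by
      have h3 := Nat.lt_ceil.1 (hC i j hij)
      have h4 : 4 * ((ω.verticesOf i ∩ ω.verticesOf j).card : ℝ) ≤ Q.card := by linarith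
      exact_mod_cast h4)
    (by
      have h4 : 16 * (10 * (b : ℝ) + 1) ≤ Q.card := by linarith
      exact_mod_cast h4)
  refine ⟨T, v, hT, fun u => (hA u).le, fun u w huw => (hB u w huw).le, ⟨i, hvi, hj⟩,
    Q \ insert v T, ?_, fun x hx => ⟨(Finset.mem_sdiff.1 hx).2, fun u hu => ?_⟩⟩
  · have h3 := Finset.card_sdiff_add_card_eq_card hTQ
    rw [Finset.card_insert_of_notMem hvT, hT] at h3
    have h4 : ((Q \ insert v T).card : ℝ) + (10 * b + 1) = Q.card := by exact_mod_cast h3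
    have h5 : (10 * b + 1 : ℝ) ≤ κ / 8 * (n * p) := by
      have h6 : κ / 8 * (b : ℝ) ^ 3 ≤ κ / 8 * (n * p) := by gcongr
      have h7 : κ / 8 * (b : ℝ) ^ 3 = κ * b ^ 2 * (b / 8) := by ring
      nlinarith
    linarith
  · rw [Finset.mem_sdiff] at hx
    obtain ⟨j, hj1, hj2⟩ := LabelChoice.exists_common_label hQ (hTQ hu) hx.1
      (fun h => hx.2 (h ▸ hu))
    exact ⟨j, (ω.mem_labelsOf _ _).2 hj1, hj2⟩

/-- The union bound costs at most `exp(11 b²)`, while the gain is at least `exp(κ² b³ / 64)`. Since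
`1408 = 11 · 128`, half of the gain absorbs the cost. -/
theorem pow_mul_exp_neg_le (hκ0 : 0 ≤ κ) (hκ1 : κ ≤ 1) (hb : (1 : ℝ) ≤ b)
    (hn : (n : ℝ) ≤ Real.exp (κ * b / 6)) (hnp : (b : ℝ) ^ 3 ≤ n * p) (hb4 : 1408 ≤ κ ^ 2 * b) :
    (n : ℝ) ^ (10 * b + 1) * Real.exp (-(κ ^ 2 / 64 * (n * p))) ≤
      Real.exp (-(κ ^ 2 * b / 128)) := by
  calc (n : ℝ) ^ (10 * b + 1) * Real.exp (-(κ ^ 2 / 64 * (n * p)))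
      ≤ Real.exp (κ * b / 6) ^ (10 * b + 1) * Real.exp (-(κ ^ 2 / 64 * b ^ 3)) := by gcongr
    _ = Real.exp ((10 * b + 1) * (κ * b / 6) + -(κ ^ 2 / 64 * b ^ 3)) := by
        rw [← Real.exp_nat_mul, ← Real.exp_add]; push_cast; rfl
    _ ≤ _ := by
        rw [Real.exp_le_exp]
        have h0 : κ * b / 6 ≤ b := by nlinarith
        have h1 : (10 * b + 1) * (κ * b / 6) ≤ 11 * (b : ℝ) * b := by
          gcongr; linarith
        have h2 : 1408 * (b : ℝ) ^ 2 ≤ κ ^ 2 * b * b ^ 2 := by gcongr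
        have h3 : κ ^ 2 * (b : ℝ) * 1 ≤ κ ^ 2 * b * b ^ 2 := by
          gcongr; exact one_le_pow₀ hb
        nlinarith

theorem massOf_large_multilabel_clique_le (hp0 : 0 < p) (hc : 1 ≤ c)
    (hκ : κ = Real.exp (-2 * (6 * c + 1))) (hmp : m * p ^ 2 ≤ c) (hpb : p * b ^ 8 ≤ 1)
    (hnp : (b : ℝ) ^ 3 ≤ n * p) (hmn : (m : ℝ) ≤ n ^ 2) (hn : (n : ℝ) ≤ Real.exp (κ * b / 6))
    (hb1 : 6 * c ≤ b) (hb2 : 40000 ≤ κ * b ^ 2) (hb3 : 8 * Real.exp (-(κ * b / 2)) ≤ κ)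
    (hb4 : 1408 ≤ κ ^ 2 * b) :
    massOf (choiceWeight p) (fun ω : LabelChoice n m => ∃ Q : Finset (Fin n),
      ω.intersectionGraph.IsClique (Q : Set (Fin n)) ∧ 2 ≤ Q.card ∧
      (1 - κ / 8) * (n * p) ≤ Q.card ∧ ¬ ω.FormedBySingleLabel Q) ≤
      3 * Real.exp (-(b / 4 : ℝ)) + Real.exp (-(κ ^ 2 * b / 128)) := by
  classical
  have hκ0 : 0 < κ := hκ ▸ Real.exp_pos _
  have hκ1 : κ ≤ 1 / 8 := by
    have h1 : Real.exp (-2 * (6 * c + 1)) ≤ Real.exp (-14) := by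
      rw [Real.exp_le_exp]; linarith
    have h2 : Real.exp (-14) ≤ 1 / 8 := by
      rw [Real.exp_neg, one_div]
      gcongr
      linarith [Real.add_one_le_exp (14 : ℝ)]
    rw [hκ]; linarith
  have hb200 : (200 : ℝ) ≤ b := by
    have : (0 : ℝ) ≤ b := by positivity
    nlinarith
  have hb0 : (0 : ℝ) < b := by linarith
  have hbN : 200 ≤ b := by exact_mod_cast hb200
  have hbpow : ∀ k : ℕ, k ≤ 8 → p * (b : ℝ) ^ k ≤ 1 := fun k hk =>
    le_trans (mul_le_mul_of_nonneg_left (pow_le_pow_right₀ (by linarith) hk) hp0.le) hpb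
  have hpb1 : p * b ≤ 1 := by simpa using hbpow 1 (by norm_num)
  have hp96 : 200 * p ≤ 1 := by nlinarith
  have hp1 : p ≤ 1 := by linarith
  have hn1 : (1 : ℝ) ≤ n := by
    have : (1 : ℝ) ≤ b ^ 3 := one_le_pow₀ (by linarith)
    have h2 : (n : ℝ) * p ≤ n * 1 := by gcongr
    linarith
  have hnp' : 40000 * (b : ℝ) ≤ n * p := by
    refine le_trans ?_ hnp
    nlinarith
  have hw := choiceWeight_nonneg (n := n) (m := m) hp0.le hp1
  set s := ⌈6 * c / p⌉₊ with hs
  -- This dictates the value of `κ`: since `s p ≤ 6c + 1` and `1 - p ≥ e^(-2p)`, a vertex avoids a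
  -- given set of `s` labels with probability at least `κ`.
  have hκs : κ ≤ (1 - p) ^ s := by
    have h1 : (s : ℝ) * p ≤ 6 * c + 1 := by
      have h2 : (s : ℝ) < 6 * c / p + 1 := Nat.ceil_lt_add_one (by positivity)
      have h3 : (s : ℝ) * p ≤ (6 * c / p + 1) * p := by gcongr
      rw [add_mul, div_mul_cancel₀ _ hp0.ne'] at h3
      linarith
    calc κ ≤ Real.exp (s * (-2 * p)) := by
          rw [hκ, Real.exp_le_exp]; linarith
      _ = Real.exp (-2 * p) ^ s := by rw [← Real.exp_nat_mul]
      _ ≤ _ := pow_le_pow_left₀ (Real.exp_pos _).le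
          (exp_neg_two_mul_le_one_sub hp0.le (by linarith)) _
  have hM : ((10 * b : ℝ) ^ 2 * b) ^ 2 * p ≤ κ / 4 := by
    have h1 : ((10 * b : ℝ) ^ 2 * b) ^ 2 * p * b ^ 2 ≤ 10000 := by
      have : ((10 * b : ℝ) ^ 2 * b) ^ 2 * p * b ^ 2 = 10000 * (p * b ^ 8) := by ring
      rw [this]; linarith
    have h2 : ((10 * b : ℝ) ^ 2 * b) ^ 2 * p * b ^ 2 ≤ κ / 4 * b ^ 2 := by linarith
    exact le_of_mul_le_mul_right h2 (by positivity)
  -- Since `1/p ≤ n` and `m + 1 ≤ 2 n²`, it suffices to absorb `2 n³ ≤ 2 exp(κ b / 2)` into `(1 -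
  -- κ)^b ≤ exp(-κ b)`.
  have hrest : ((m : ℝ) + 1) * (1 - κ) ^ b ≤ κ / 4 * p := by
    have h1 : (1 - κ) ^ b ≤ Real.exp (-(κ * b)) := by
      calc (1 - κ) ^ b ≤ Real.exp (-κ) ^ b := by
            refine pow_le_pow_left₀ (by linarith) ?_ _
            linarith [Real.add_one_le_exp (-κ)]
        _ = _ := by rw [← Real.exp_nat_mul]; congr 1; ring
    have h2 : (n : ℝ) * (m + 1) ≤ 2 * Real.exp (κ * b / 2) := by
      calc (n : ℝ) * (m + 1) ≤ n * (n ^ 2 + n ^ 2) := by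
            gcongr; exact one_le_pow₀ hn1
        _ = 2 * (n : ℝ) ^ 3 := by ring
        _ ≤ 2 * Real.exp (κ * b / 6) ^ 3 := by gcongr
        _ = _ := by rw [← Real.exp_nat_mul]; congr 2; push_cast; ring
    have h3 : (n : ℝ) * ((m + 1) * (1 - κ) ^ b) ≤ κ / 4 := by
      calc (n : ℝ) * ((m + 1) * (1 - κ) ^ b) = (n * (m + 1)) * (1 - κ) ^ b := by ring
        _ ≤ 2 * Real.exp (κ * b / 2) * Real.exp (-(κ * b)) := by
            have : 0 ≤ (1 - κ) ^ b := pow_nonneg (by linarith) _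
            gcongr
        _ = 2 * Real.exp (-(κ * b / 2)) := by
            rw [mul_assoc, ← Real.exp_add]; congr 2; ring
        _ ≤ κ / 4 := by linarith
    have h4 : κ / 4 ≤ n * (κ / 4 * p) := by
      have : (1 : ℝ) ≤ n * p := by linarith
      nlinarith
    exact le_of_mul_le_mul_left (h3.trans h4) (by linarith)
  have hm3 : m ≤ 3 ^ b := by
    have : (m : ℝ) ≤ 3 ^ b := by
      calc (m : ℝ) ≤ n ^ 2 := hmn
        _ ≤ Real.exp (κ * b / 6) ^ 2 := by gcongr
        _ = Real.exp (κ * b / 3) := by rw [← Real.exp_nat_mul]; congr 1; push_cast; ring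
        _ ≤ Real.exp (b * 1) := by rw [Real.exp_le_exp]; nlinarith
        _ = Real.exp 1 ^ b := by rw [Real.exp_nat_mul]
        _ ≤ 3 ^ b := by
          have := Real.exp_one_lt_d9
          gcongr; linarith
    exact_mod_cast this
  -- The prefactors `n`, `n²` and `m²` of the three exceptional events are all at most `n⁴`.
  have hhalf : ∀ x : ℝ, 0 ≤ x → x ≤ (n : ℝ) ^ 4 → x * (1 / 2) ^ b ≤ Real.exp (-(b / 4 : ℝ)) := by
    intro x hx0 hx
    calc x * (1 / 2) ^ b ≤ (Real.exp (κ * b / 6)) ^ 4 * Real.exp (-(b / 2 : ℝ)) := by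
          have := half_pow_le_exp b
          have h3 : x ≤ (Real.exp (κ * b / 6)) ^ 4 := hx.trans (by gcongr)
          gcongr
      _ = Real.exp (4 * (κ * b / 6) + -(b / 2)) := by
          rw [← Real.exp_nat_mul, ← Real.exp_add]; push_cast; rfl
      _ ≤ _ := by rw [Real.exp_le_exp]; nlinarith
  have b1 := (massOf_exists_card_labelsOf_ge_ceil (n := n) hp0 hp1 hc hmp hpb1).trans
    (hhalf n (by positivity) (by simpa using pow_le_pow_right₀ hn1 (show 1 ≤ 4 by norm_num)))
  have b2 := (massOf_exists_card_labelsOf_inter_ge_half_pow (n := n) hp0 hp1 (by omega) hmp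
    hb1).trans (hhalf (n ^ 2) (by positivity) (pow_le_pow_right₀ hn1 (by norm_num)))
  have b3 := (massOf_exists_card_verticesOf_inter_ge_ceil (n := n) (m := m) (b := b) hp0
    (by linarith) (by omega) (by linarith)).trans (hhalf (m ^ 2) (by positivity) (by
      calc (m : ℝ) ^ 2 ≤ ((n : ℝ) ^ 2) ^ 2 := by gcongr
        _ = _ := by ring))
  have b4 : massOf (choiceWeight p) (fun ω : LabelChoice n m =>
      ω.HasManyCommonNeighbours s b ((1 - κ / 4) * (n * p))) ≤
      Real.exp (-(κ ^ 2 * b / 128)) := by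
    refine (massOf_exists_many_common_neighbours_le hp0 hp1 hκ0 (by linarith) hκs hM
      hrest).trans ?_
    exact pow_mul_exp_neg_le (by linarith) (by linarith) (by linarith) hn hnp hb4
  calc _ ≤ _ := massOf_mono hw fun ω ⟨Q, hQ, h2, hQt, hns⟩ =>
        LabelChoice.hasManyCommonNeighbours_of_isClique (s := s) hκ0 hκ1 hb200 hb2 hnp hnp' hm3 hQ
          h2 hQt hns
    _ ≤ _ := (massOf_or_le hw _ _).trans (add_le_add ((massOf_or_le hw _ _).trans
        (add_le_add ((massOf_or_le hw _ _).trans (add_le_add b1 b2)) b3)) b4)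
    _ = _ := by ring

end bounds

/-! ### Maximum cliques, the sparse case and passage to the limit -/

namespace LabelChoice

variable {n m : ℕ}

/-- Some clique with at least `t` and at least two vertices is not formed by a single label. -/
def HasMultilabelClique (ω : LabelChoice n m) (t : ℝ) : Prop :=
  ∃ Q : Finset (Fin n), ω.intersectionGraph.IsClique (Q : Set (Fin n)) ∧ 2 ≤ Q.card ∧
    t ≤ Q.card ∧ ¬ ω.FormedBySingleLabel Q

/-- Some maximum clique with at least two vertices is not formed by a single label. -/
def HasMultilabelMaximumClique (ω : LabelChoice n m) : Prop :=
  ∃ Q : Finset (Fin n), ω.intersectionGraph.IsMaximumClique Q ∧ 2 ≤ Q.card ∧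
    ¬ ω.FormedBySingleLabel Q

theorem isClique_verticesOf (ω : LabelChoice n m) (i : Fin m) :
    ω.intersectionGraph.IsClique (ω.verticesOf i : Set (Fin n)) := by
  intro u hu v hv huv
  rw [Finset.mem_coe, ω.mem_verticesOf] at hu hv
  exact ⟨huv, i, by rw [Finset.mem_inter, ω.mem_labelsOf, ω.mem_labelsOf]; exact ⟨hu, hv⟩⟩

/-- The set `L_i` is a clique, so a maximum clique is at least as large; thus a lower tail bound for
one label reduces maximum cliques to large ones. -/
theorem HasMultilabelMaximumClique.hasMultilabelClique_or {ω : LabelChoice n m}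
    (h : ω.HasMultilabelMaximumClique) (i : Fin m) (t : ℝ) :
    ω.HasMultilabelClique t ∨ ((ω.verticesOf i).card : ℝ) ≤ t := by
  obtain ⟨Q, hQ, h2, hns⟩ := h
  rcases le_total ((ω.verticesOf i).card : ℝ) t with hle | hle
  · exact Or.inr hle
  · have h3 : ((ω.verticesOf i).card : ℝ) ≤ Q.card :=
      Nat.cast_le.2 (hQ.maximum _ (ω.isClique_verticesOf i))
    exact Or.inl ⟨Q, hQ.isClique, h2, hle.trans h3, hns⟩

end LabelChoice

section whp

variable {n m b : ℕ} {p c κ : ℝ}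

/-- First moment of triangles with three different labels; the size threshold is 0 because cliques
of every size are excluded here. -/
theorem massOf_hasMultilabelClique_le_of_sparse (h0 : 0 ≤ p) (h1 : p ≤ 1) (hb : 0 < b)
    (h : b * (n * m * p ^ 2) ≤ 1) :
    massOf (choiceWeight p) (fun ω : LabelChoice n m => ω.HasMultilabelClique 0) ≤
      (1 / b : ℝ) ^ 3 := by
  refine (massOf_mono (choiceWeight_nonneg h0 h1) fun ω ⟨Q, hQ, h2, _, hns⟩ =>
    LabelChoice.exists_multilabel_triangle hQ h2 hns).trans
    ((massOf_exists_multilabel_triangle h0 h1).trans ?_)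
  refine pow_le_pow_left₀ (by positivity) ?_ 3
  rw [le_div_iff₀ (by exact_mod_cast hb)]
  linarith

theorem massOf_card_verticesOf_le_exp_neg (h0 : 0 ≤ p) (h1 : p ≤ 1) (hκ0 : 0 ≤ κ) (hκ1 : κ ≤ 1)
    (hb : 1 ≤ b) (hnp : (b : ℝ) ^ 3 ≤ n * p) (i : Fin m) :
    massOf (choiceWeight p) (fun ω : LabelChoice n m =>
      ((ω.verticesOf i).card : ℝ) ≤ (1 - κ / 8) * (n * p)) ≤ Real.exp (-(κ ^ 2 * b / 256)) := by
  refine (massOf_card_verticesOf_le h0 h1 i (y := κ / 16) (by linarith) (by linarith) _).trans ?_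
  rw [Real.exp_le_exp]
  have hb' : (1 : ℝ) ≤ b := by exact_mod_cast hb
  have h2 : (b : ℝ) ≤ n * p := le_trans (le_self_pow₀ hb' (by norm_num)) hnp
  have h3 : κ ^ 2 * (b : ℝ) ≤ κ ^ 2 * (n * p) := by gcongr
  nlinarith

theorem tendsto_randomLabelChoice_one {m : ℕ → ℕ} {p : ℕ → unitInterval}
    (s : ∀ n, Set (LabelChoice n (m n))) (P : ∀ n, LabelChoice n (m n) → Prop) {g : ℕ → ℝ}
    (hg : Tendsto g atTop (𝓝 0)) (hs : ∀ᶠ n in atTop, ∀ ω, ω ∉ s n → P n ω)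
    (hP : ∀ᶠ n in atTop, massOf (choiceWeight (p n : ℝ)) (P n) ≤ g n) :
    Tendsto (fun n => randomLabelChoice n (m n) (p n) (s n)) atTop (𝓝 1) := by
  have hprob : ∀ n, IsProbabilityMeasure (randomLabelChoice n (m n) (p n)) := fun n => by
    unfold randomLabelChoice; infer_instance
  rw [← ENNReal.tendsto_toReal_iff (fun n => measure_ne_top _ _) ENNReal.one_ne_top,
    ENNReal.toReal_one]
  refine tendsto_of_tendsto_of_tendsto_of_le_of_le' (g := fun n => 1 - g n)
    (by simpa using hg.const_sub 1) tendsto_const_nhds ?_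
    (Eventually.of_forall fun n => measureReal_le_one)
  filter_upwards [hs, hP] with n hs hP
  have h1 := probReal_compl_eq_one_sub (μ := randomLabelChoice n (m n) (p n))
    (s := s n) (MeasurableSet.of_discrete)
  rw [randomLabelChoice_real] at h1
  have h2 := massOf_mono (choiceWeight_nonneg (p n).2.1 (p n).2.2) (P := (· ∈ (s n)ᶜ)) (Q := P n) hs
  change _ ≤ (randomLabelChoice n (m n) (p n)).real (s n)
  linarith

end whp

/-! ### Choice of the scale and the sparse/dense dichotomy -/

section asymptotics

theorem tendsto_natCast_rpow_atTop {a : ℝ} (ha : 0 < a) :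
    Tendsto (fun n : ℕ => (n : ℝ) ^ a) atTop atTop :=
  (tendsto_rpow_atTop ha).comp tendsto_natCast_atTop_atTop

theorem eventually_le_exp_mul_rpow {a η : ℝ} (ha : 0 < a) (hη : 0 < η) :
    ∀ᶠ n : ℕ in atTop, (n : ℝ) ≤ Real.exp (η * (n : ℝ) ^ a) := by
  have h := ((isLittleO_log_rpow_atTop ha).comp_tendsto tendsto_natCast_atTop_atTop).def hη
  filter_upwards [h, eventually_gt_atTop 0] with n hn hn0
  have hn0' : (0 : ℝ) < n := by exact_mod_cast hn0
  rw [← Real.log_le_iff_le_exp hn0']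
  refine (le_abs_self _).trans ?_
  simpa [abs_of_nonneg (Real.rpow_nonneg hn0'.le a)] using hn

theorem eventually_half_rpow_le_and_le_two_rpow {α : ℝ} {m : ℕ → ℕ}
    (hm : (fun n : ℕ => (m n : ℝ)) ~[atTop] fun n : ℕ => (n : ℝ) ^ α) :
    ∀ᶠ n : ℕ in atTop, (n : ℝ) ^ α ≤ 2 * m n ∧ (m n : ℝ) ≤ 2 * (n : ℝ) ^ α := by
  filter_upwards [hm.isLittleO.def (show (0 : ℝ) < 1 / 2 by norm_num)] with n hn
  have h0 : 0 ≤ (n : ℝ) ^ α := Real.rpow_nonneg (Nat.cast_nonneg n) α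
  simp only [Pi.sub_apply, Real.norm_eq_abs, abs_of_nonneg h0] at hn
  have := abs_le.1 hn
  constructor <;> linarith

/-- The bound on `m p²` gives `p² ≤ 2c x^(-a)`, which outweighs `b^16 ≤ 2^16 x^(16β)` once `x^(a -
16β) ≥ 2^17 c`. -/
theorem mul_pow_eight_le_one {x m p b c a β : ℝ} (hx : 0 < x) (hm : x ^ a ≤ 2 * m)
    (hp0 : 0 ≤ p) (hmp : m * p ^ 2 ≤ c) (hb0 : 0 ≤ b) (hb : b ≤ 2 * x ^ β)
    (h : 2 ^ 17 * c ≤ x ^ (a - 16 * β)) : p * b ^ 8 ≤ 1 := by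
  have ha : 0 < x ^ a := Real.rpow_pos_of_pos hx a
  have hβ : 0 < x ^ β := Real.rpow_pos_of_pos hx β
  have h1 : x ^ a * p ^ 2 ≤ 2 * c := by nlinarith [sq_nonneg p]
  have h2 : (x ^ β) ^ 16 * x ^ (a - 16 * β) = x ^ a := by
    rw [← Real.rpow_natCast (x ^ β), ← Real.rpow_mul hx.le, ← Real.rpow_add hx]
    congr 1; push_cast; ring
  have h3 : x ^ a * (p * b ^ 8) ^ 2 ≤ x ^ a * 1 := by
    calc x ^ a * (p * b ^ 8) ^ 2 = x ^ a * p ^ 2 * b ^ 16 := by ring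
      _ ≤ x ^ a * p ^ 2 * (2 * x ^ β) ^ 16 := by gcongr
      _ ≤ 2 * c * (2 * x ^ β) ^ 16 := by gcongr
      _ = (x ^ β) ^ 16 * (2 ^ 17 * c) := by ring
      _ ≤ (x ^ β) ^ 16 * x ^ (a - 16 * β) := by gcongr
      _ = x ^ a * 1 := by rw [h2, mul_one]
  have h4 : (p * b ^ 8) ^ 2 ≤ 1 := le_of_mul_le_mul_left h3 ha
  exact (sq_le_one_iff₀ (by positivity)).1 h4

/-- Density gives `(xp)² > x / (b m) ≥ x^(1-a) / (2b)`, and this is at least `b⁶` because `2 x^a b⁷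
≤ x`. -/
theorem pow_three_le_mul {x m p b a β : ℝ} (hx : 0 < x) (hm : m ≤ 2 * x ^ a)
    (hp0 : 0 ≤ p) (hb0 : 0 ≤ b) (hb : b ≤ 2 * x ^ β)
    (h : 2 ^ 8 ≤ x ^ (1 - a - 7 * β)) (hbig : 1 < b * (x * m * p ^ 2)) : b ^ 3 ≤ x * p := by
  have ha : 0 < x ^ a := Real.rpow_pos_of_pos hx a
  have hβ : 0 < x ^ β := Real.rpow_pos_of_pos hx β
  have h2 : x ^ a * (x ^ β) ^ 7 * x ^ (1 - a - 7 * β) = x := by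
    rw [← Real.rpow_natCast (x ^ β), ← Real.rpow_mul hx.le, ← Real.rpow_add hx, ← Real.rpow_add hx]
    conv_rhs => rw [← Real.rpow_one x]
    congr 1; push_cast; ring
  have h3 : 2 * x ^ a * b ^ 7 ≤ x := by
    calc 2 * x ^ a * b ^ 7 ≤ 2 * x ^ a * (2 * x ^ β) ^ 7 := by gcongr
      _ = x ^ a * (x ^ β) ^ 7 * 2 ^ 8 := by ring
      _ ≤ x ^ a * (x ^ β) ^ 7 * x ^ (1 - a - 7 * β) := by gcongr
      _ = x := h2
  have hbpos : 0 < b := hb0.lt_of_ne fun h => by rw [← h] at hbig; norm_num at hbig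
  have h4 : x < 2 * x ^ a * b * (x * p) ^ 2 := by
    calc x = x * 1 := by ring
      _ < x * (b * (x * m * p ^ 2)) := by gcongr
      _ = m * (b * (x * p) ^ 2) := by ring
      _ ≤ 2 * x ^ a * (b * (x * p) ^ 2) := by gcongr
      _ = _ := by ring
  have h5 : (2 * x ^ a * b) * (b ^ 3) ^ 2 ≤ (2 * x ^ a * b) * (x * p) ^ 2 := by
    calc (2 * x ^ a * b) * (b ^ 3) ^ 2 = 2 * x ^ a * b ^ 7 := by ring
      _ ≤ _ := by linarith
  have h6 := le_of_mul_le_mul_left h5 (by positivity)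
  exact (pow_le_pow_iff_left₀ (by positivity) (by positivity) two_ne_zero).1 h6

/-- With high probability there is no large clique and no maximum clique that is not formed by a
single label. -/
theorem exists_massOf_multilabel_le {α : ℝ} (hα₀ : 0 < α) (hα₁ : α < 1) {m : ℕ → ℕ}
    (hm : (fun n : ℕ => (m n : ℝ)) ~[atTop] fun n : ℕ => (n : ℝ) ^ α) {p : ℕ → unitInterval}
    (hp : (fun n : ℕ => (m n : ℝ) * (p n : ℝ) ^ 2) =O[atTop] fun _ : ℕ => (1 : ℝ)) :
    ∃ κ : ℝ, 0 < κ ∧ ∃ g : ℕ → ℝ, Tendsto g atTop (𝓝 0) ∧ ∀ᶠ n in atTop,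
      massOf (choiceWeight (p n : ℝ)) (fun ω : LabelChoice n (m n) =>
        ω.HasMultilabelClique ((1 - κ / 8) * (n * (p n : ℝ)))) ≤ g n ∧
      massOf (choiceWeight (p n : ℝ)) (fun ω : LabelChoice n (m n) =>
        ω.HasMultilabelMaximumClique) ≤ g n := by
  obtain ⟨C, hC⟩ := hp.bound
  set c := max 1 C with hc
  have hc1 : 1 ≤ c := le_max_left _ _
  set κ := Real.exp (-2 * (6 * c + 1)) with hκ
  have hκ0 : 0 < κ := Real.exp_pos _
  have hκ1 : κ ≤ 1 := by rw [hκ, Real.exp_le_one_iff]; linarith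
  -- Small enough for both `16 β < α` and `7 β < 1 - α`.
  set β := α * (1 - α) / 20 with hβ
  have hα1' : 0 < 1 - α := by linarith
  have hβ0 : 0 < β := by positivity
  have hβ1 : 0 < α - 16 * β := by rw [hβ]; nlinarith
  have hβ2 : 0 < 1 - α - 7 * β := by rw [hβ]; nlinarith
  set b : ℕ → ℕ := fun n => ⌈(n : ℝ) ^ β⌉₊ with hb
  have hble : ∀ n : ℕ, (n : ℝ) ^ β ≤ b n := fun n => Nat.le_ceil _
  have hbt : Tendsto (fun n => (b n : ℝ)) atTop atTop :=
    tendsto_atTop_mono hble (tendsto_natCast_rpow_atTop hβ0)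
  have hexp : ∀ a : ℝ, 0 < a → Tendsto (fun n : ℕ => Real.exp (-(a * b n))) atTop (𝓝 0) := fun a ha =>
    Real.tendsto_exp_neg_atTop_nhds_zero.comp (hbt.const_mul_atTop ha)
  refine ⟨κ, hκ0, fun n : ℕ => (1 / b n : ℝ) ^ 3 + (3 * Real.exp (-(1 / 4 * b n)) +
    Real.exp (-(κ ^ 2 / 128 * b n))) + Real.exp (-(κ ^ 2 / 256 * b n)), ?_, ?_⟩
  · have h1 : Tendsto (fun n : ℕ => (1 / b n : ℝ) ^ 3) atTop (𝓝 0) := by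
      simpa using ((tendsto_inv_atTop_zero.comp hbt).pow 3)
    simpa using (h1.add (((hexp (1 / 4) (by norm_num)).const_mul 3).add
      (hexp (κ ^ 2 / 128) (by positivity)))).add (hexp (κ ^ 2 / 256) (by positivity))
  have hexp8 : ∀ᶠ n : ℕ in atTop, Real.exp (-(κ / 2 * b n)) < κ / 8 :=
    (hexp (κ / 2) (by positivity)).eventually_lt_const (by positivity)
  filter_upwards [hC, eventually_half_rpow_le_and_le_two_rpow hm, eventually_ge_atTop 2,
    (tendsto_natCast_rpow_atTop hβ1).eventually_ge_atTop (2 ^ 17 * c),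
    (tendsto_natCast_rpow_atTop hβ2).eventually_ge_atTop (2 ^ 8),
    eventually_le_exp_mul_rpow hβ0 (show 0 < κ / 6 by positivity), hexp8,
    hbt.eventually_ge_atTop (6 * c), hbt.eventually_ge_atTop (40000 / κ),
    hbt.eventually_ge_atTop (1408 / κ ^ 2)] with n hCn hmn hn2 hn17 hn8 hnexp hexp8 hb1 hb2 hb4
  have hp0 : 0 ≤ (p n : ℝ) := (p n).2.1
  have hp1 : (p n : ℝ) ≤ 1 := (p n).2.2
  have hn2' : (2 : ℝ) ≤ n := by exact_mod_cast hn2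
  have hn0 : (0 : ℝ) < n := by linarith
  have hb1' : (1 : ℝ) ≤ b n := by linarith
  have hbN : 1 ≤ b n := by exact_mod_cast hb1'
  have hw := choiceWeight_nonneg (n := n) (m := m n) hp0 hp1
  have hmp : (m n : ℝ) * (p n : ℝ) ^ 2 ≤ c := by
    rw [norm_one, mul_one] at hCn
    exact (le_abs_self _).trans (hCn.trans (le_max_right _ _))
  have hb2n : (b n : ℝ) ≤ 2 * (n : ℝ) ^ β := by
    have h1 : (1 : ℝ) ≤ (n : ℝ) ^ β := Real.one_le_rpow (by linarith) hβ0.le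
    have h2 : (b n : ℝ) < (n : ℝ) ^ β + 1 := Nat.ceil_lt_add_one (by linarith)
    linarith
  have hpos1 : 0 ≤ (1 / b n : ℝ) ^ 3 := by positivity
  have hpos2 := Real.exp_pos (-(1 / 4 * b n : ℝ))
  have hpos3 := Real.exp_pos (-(κ ^ 2 / 128 * b n))
  have hpos4 := Real.exp_pos (-(κ ^ 2 / 256 * b n))
  -- The sequence `p` may alternate between the two regimes, so the split is made for each `n` and
  -- `g` sums the bounds of both.
  rcases le_or_gt ((b n : ℝ) * (n * m n * (p n : ℝ) ^ 2)) 1 with hsparse | hdense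
  · have h1 := massOf_hasMultilabelClique_le_of_sparse hp0 hp1 hbN hsparse
    constructor
    · refine (massOf_mono hw fun ω ⟨Q, hQ, h2, _, hns⟩ => ?_).trans (h1.trans (by linarith))
      exact ⟨Q, hQ, h2, by positivity, hns⟩
    · refine (massOf_mono hw fun ω ⟨Q, hQ, h2, hns⟩ => ?_).trans (h1.trans (by linarith))
      exact ⟨Q, hQ.isClique, h2, by positivity, hns⟩
  · have hnp := pow_three_le_mul hn0 hmn.2 hp0 (by linarith) hb2n hn8 hdense
    have hp0' : 0 < (p n : ℝ) := by
      refine hp0.lt_of_ne fun h => ?_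
      rw [← h] at hdense
      norm_num at hdense
    have hm2 : (m n : ℝ) ≤ (n : ℝ) ^ 2 := by
      have : (n : ℝ) ^ α ≤ (n : ℝ) ^ (1 : ℝ) :=
        Real.rpow_le_rpow_of_exponent_le (by linarith) hα₁.le
      rw [Real.rpow_one] at this
      nlinarith
    have hmpos : 0 < m n := by
      have : 0 < (n : ℝ) ^ α := Real.rpow_pos_of_pos hn0 α
      have : (0 : ℝ) < m n := by linarith
      exact_mod_cast this
    have hbound := massOf_large_multilabel_clique_le (n := n) (m := m n) (b := b n) hp0' hc1 hκ hmp
      (mul_pow_eight_le_one hn0 hmn.1 hp0 hmp (by linarith) hb2n hn17) hnp hm2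
      (hnexp.trans (by
        rw [Real.exp_le_exp, mul_div_right_comm]
        exact mul_le_mul_of_nonneg_left (hble n) (by positivity))) hb1
      (by
        rw [div_le_iff₀ hκ0] at hb2
        nlinarith)
      (by
        rw [mul_div_right_comm]; linarith)
      (by
        rw [div_le_iff₀ (by positivity)] at hb4
        linarith)
    have e1 : -((b n : ℝ) / 4) = -(1 / 4 * b n) := by ring
    have e2 : -(κ ^ 2 * (b n : ℝ) / 128) = -(κ ^ 2 / 128 * b n) := by ring
    have e3 : -(κ ^ 2 * (b n : ℝ) / 256) = -(κ ^ 2 / 256 * b n) := by ring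
    rw [e1, e2] at hbound
    have htail := massOf_card_verticesOf_le_exp_neg hp0 hp1 hκ0.le hκ1 hbN hnp
      (⟨0, hmpos⟩ : Fin (m n))
    rw [e3] at htail
    constructor
    · exact hbound.trans (by linarith)
    · exact (massOf_mono hw fun ω hω => hω.hasMultilabelClique_or ⟨0, hmpos⟩
        ((1 - κ / 8) * (n * (p n : ℝ)))).trans ((massOf_or_le hw _ _).trans
        ((add_le_add hbound htail).trans (by linarith)))

end asymptotics

theorem theorem3 (α : ℝ) (hα₀ : 0 < α) (hα₁ : α < 1)
    (m : ℕ → ℕ) (hm : (fun n : ℕ => (m n : ℝ)) ~[atTop] fun n : ℕ => (n : ℝ) ^ α)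
    (p : ℕ → unitInterval)
    (hp : (fun n : ℕ => (m n : ℝ) * (p n : ℝ) ^ 2) =O[atTop] fun _ : ℕ => (1 : ℝ)) :
    (∀ ε : ℕ → ℝ, Tendsto ε atTop (𝓝 0) →
      Tendsto (fun n : ℕ => randomLabelChoice n (m n) (p n)
        {ω | ∀ Q : Finset (Fin n), ω.intersectionGraph.IsClique (Q : Set (Fin n)) →
          2 ≤ Q.card → |(Q.card : ℝ) - n * (p n : ℝ)| ≤ ε n * (n * (p n : ℝ)) →
          ω.FormedBySingleLabel Q}) atTop (𝓝 1)) ∧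
    Tendsto (fun n : ℕ => randomLabelChoice n (m n) (p n)
      {ω | ∀ Q : Finset (Fin n), ω.intersectionGraph.IsMaximumClique Q →
        2 ≤ Q.card → ω.FormedBySingleLabel Q}) atTop (𝓝 1) := by
  obtain ⟨κ, hκ, g, hg, hbound⟩ := exists_massOf_multilabel_le hα₀ hα₁ hm hp
  refine ⟨fun ε hε => tendsto_randomLabelChoice_one _ _ hg ?_ (hbound.mono fun n h => h.1),
    tendsto_randomLabelChoice_one _ _ hg (Eventually.of_forall fun n ω hω => ?_)
      (hbound.mono fun n h => h.2)⟩
  · filter_upwards [hε.eventually_le_const (show 0 < κ / 8 by positivity)] with n hn ω hω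
    simp only [not_forall] at hω
    obtain ⟨Q, hQ, h2, hQn, hns⟩ := hω
    refine ⟨Q, hQ, h2, ?_, hns⟩
    have h3 := (abs_le.1 hQn).1
    have h4 : ε n * (n * (p n : ℝ)) ≤ κ / 8 * (n * (p n : ℝ)) :=
      mul_le_mul_of_nonneg_right hn (mul_nonneg (Nat.cast_nonneg n) (p n).2.1)
    linarith
  · simp only [Set.mem_ofPred_eq, not_forall] at hω
    obtain ⟨Q, hQ, h2, hns⟩ := hω
    exact ⟨Q, hQ, h2, hns⟩
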